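/- Let $k$ be an algebraically closed field of characteristic $0$. A \emph{nodal curve} is a reduced proper $k$-scheme $C$ each of whose closed points is either a smooth point of dimension one or a node, i.e. a point $x$ with $\widehat{\mathcal O}_{C,x}\cong k[[X,Y]]/(XY)$ over $k$. Let $\nu\colon\widetilde C\to C$ be the normalization and let $\mathfrak c_x=\{a\in\mathcal O_{C,x} : a\,(\nu_*\mathcal O_{\widetilde C})_x\subset\mathcal O_{C,x}\}$ be the conductor at $x$. For a meromorphic differential $\eta$ on $\widetilde C$ (one differential of the function field for each irreducible component of $C$) and a closed point $x\in C$ we say that * $\eta$ has \emph{allowed poles} at $x$ if its principal parts above $x$ are annihilated by the conductor, i.e. $f\eta$ is regular at all points above $x$ for every $f\in\mathfrak c_x$; * $\eta$ is \emph{conductor-level balanced} at $x$ if it has allowed poles at $x$ and moreover satisfies the conductor constraints $\sum_{P\mapsto x}\operatorname{Res}_P(f\eta)=0$ for all $f\in\mathcal O_{C,x}$ (for $\eta$ with allowed poles the left side depends only on $f$ modulo $\mathfrak c_x$); * $\eta$ \emph{descends} at $x$ if it lies in the stalk $\omega_{C,x}$ of the dualizing sheaf, which on a reduced curve is the sheaf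 of regular differentials of Rosenlicht and Serre: $\sum_{P\mapsto x}\operatorname{Res}_P(f\eta)=0$ for all $f\in\mathcal O_{C,x}$. Let $H^0(\widetilde C,\omega_{\widetilde C}(\text{allowed poles}))$ be the space of meromorphic differentials with allowed poles at all closed points of $C$, and $H^0(C,\omega_C)$ the space of those that descend at all closed points. The number of conductor constraints is the rank of the linear map given by all conductor constraints on $H^0(\widetilde C,\omega_{\widetilde C}(\text{allowed poles}))$ (the number of linearly independent ones). The curve $C$ satisfies \emph{maximal variation} if every element of $H^0(C,\omega_C)$ is conductor-level balanced at all closed points, conversely every meromorphic differential that is conductor-level balanced at all closed points lies in $H^0(C,\omega_C)$ (there are no additional constraints), and $$\dim H^0(C,\omega_C)+(\text{number of conductor constraints})=\dim H^0(\widetilde C,\omega_{\widetilde C}(\text{allowed poles})).$$ **Statement.** Let $C$ be a nodal curve over $k$. 1. At every node $x$ of $C$ the conductor is the maximal ideal, $\mathfrak c_x=\mathfrak m_x$. There are exactly two points $P\ne Q$ of $\widetilde C$ above $x$, and for every meromorphic differential $\eta$ on $\widetilde C$ the following are equivalent: (a) $\eta$ is conductor-level balanced at $x$; (b) $\eta$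 descends at $x$; (c) $\eta$ has at most simple poles at $P$ and $Q$ and $\operatorname{Res}_P\eta+\operatorname{Res}_Q\eta=0$. Each node imposes exactly one linear constraint on principal parts: modulo differentials regular above $x$, the differentials with allowed poles at $x$ form a space of dimension $2$ and the conductor-level balanced ones a space of dimension $1$. 2. $C$ satisfies maximal variation. In particular, for all $g,n\ge 0$, every stable $n$-pointed curve of genus $g$ over $k$ (a connected nodal curve with $\dim H^1(C,\mathcal O_C)=g$, with $n$ distinct smooth marked points and finitely many automorphisms fixing them) satisfies maximal variation, that is, it lies in the maximal-variation locus $\overline{\mathcal M}_{g,n}^{\mathrm{mv}}\subset\overline{\mathcal M}_{g,n}$ of stable curves satisfying maximal variation. -/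

import Mathlib

open AlgebraicGeometry CategoryTheory

universe u

namespace NodalMV

noncomputable section

/-! ## Residues at a discrete valuation ring of a function field -/

section Residue

variable (k : Type u) [Field k] {K : Type u} [Field K] [Algebra k K]

/-- The differentials of `K / k` that are regular at the valuation ring `V`: the image of the
differentials of `V / k`, i.e. the finite sums of `v dw` with `v, w ∈ V`. -/
def regularForms (V : ValuationSubring K) : Submodule k (Ω[K⁄k]) :=
  Submodule.span k {ω | ∃ v ∈ V, ∃ w ∈ V, ω = v • KaehlerDifferential.D k K w}

/-- `r` is the residue functional of the discrete valuation ring `V` (with residue field `k`),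
computed in a uniformizer `t`:  it sends `(∑ i, a i * t ^ (-i) + h) dt`, with `a i ∈ k` and
`h ∈ V`, to the coefficient `a 1`. -/
def IsResidue (V : ValuationSubring K) (r : Ω[K⁄k] →ₗ[k] k) : Prop :=
  ∃ t : V, Irreducible t ∧
    (∀ ω ∈ regularForms k V, r ω = 0) ∧
    ∀ n : ℕ, r (((t : K)⁻¹ ^ (n + 1)) • KaehlerDifferential.D k K (t : K)) = if n = 0 then 1 else 0

open Classical in
/-- The residue at `V`. For the local ring `V` of a smooth curve over an algebraically closed field
`k`, each uniformizer determines a unique functional as in `IsResidue`, and it is classical that it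
does not depend on the uniformizer. -/
def residue (V : ValuationSubring K) : Ω[K⁄k] →ₗ[k] k :=
  if h : ∃ r, IsResidue k V r then h.choose else 0

end Residue

/-! ## Local rings and rational functions of a curve -/

variable {k : Type u} [Field k]

/-- The local ring of the `k`-scheme `C` at `x`. -/
def LocRing (C : Over (Spec (CommRingCat.of k))) (x : C.left) : Type u :=
  C.left.presheaf.stalk x

instance (C : Over (Spec (CommRingCat.of k))) (x : C.left) : CommRing (LocRing C x) :=
  inferInstanceAs (CommRing (C.left.presheaf.stalk x))

instance (C : Over (Spec (CommRingCat.of k))) (x : C.left) : IsLocalRing (LocRing C x) :=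
  inferInstanceAs (IsLocalRing (C.left.presheaf.stalk x))

instance (C : Over (Spec (CommRingCat.of k))) (x : C.left) : Algebra k (LocRing C x) :=
  RingHom.toAlgebra (CommRingCat.Hom.hom
    ((Scheme.ΓSpecIso (CommRingCat.of k)).inv ≫ C.hom.appTop ≫
      C.left.presheaf.germ ⊤ x trivial) : k →+* C.left.presheaf.stalk x)

/-- The residue field of `C` at `ξ`. If `C` is reduced and `ξ` is the generic point of an
irreducible component, this is the function field of that component. -/
def FunField (C : Over (Spec (CommRingCat.of k))) (ξ : C.left) : Type u :=
  C.left.residueField ξ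

instance (C : Over (Spec (CommRingCat.of k))) (ξ : C.left) : Field (FunField C ξ) :=
  inferInstanceAs (Field (C.left.residueField ξ))

/-- For `ξ` specializing to `x`, the map from the local ring at `x` to the residue field at `ξ`. -/
def toFunField (C : Over (Spec (CommRingCat.of k))) {ξ x : C.left} (h : ξ ⤳ x) :
    LocRing C x →+* FunField C ξ :=
  CommRingCat.Hom.hom (C.left.presheaf.stalkSpecializes h ≫ C.left.residue ξ)

instance (C : Over (Spec (CommRingCat.of k))) (ξ : C.left) : Algebra k (FunField C ξ) :=
  RingHom.toAlgebra ((toFunField C (specializes_refl ξ)).comp (algebraMap k (LocRing C ξ)))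

/-- The ring of rational functions on `C` near `x`: the product of the function fields of the
irreducible components through `x`. For reduced `C` it is the total ring of fractions of the local
ring at `x`. -/
abbrev RatAt (C : Over (Spec (CommRingCat.of k))) (x : C.left) : Type u :=
  ∀ ξ : {ξ : genericPoints C.left // (ξ : C.left) ⤳ x}, FunField C ξ.1

/-- The map from the local ring at `x` to the rational functions near `x`. -/
def toRatAt (C : Over (Spec (CommRingCat.of k))) (x : C.left) : LocRing C x →+* RatAt C x :=
  RingHom.pi fun ξ => toFunField C ξ.2

/-! ## Normalization and conductor -/

/-- The conductor ideal at `x`: the `a` in the local ring `O` such that `a Õ ⊆ O`, where `Õ` is the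
integral closure of `O` in its ring of rational functions (the stalk at `x` of `ν_* O_{C~}`). -/
def conductor (C : Over (Spec (CommRingCat.of k))) (x : C.left) : Ideal (LocRing C x) where
  carrier := {a | ∀ q : RatAt C x, (toRatAt C x).IsIntegralElem q →
    toRatAt C x a * q ∈ (toRatAt C x).range}
  add_mem' := by
    intro a b ha hb q hq
    rw [map_add, add_mul]
    exact add_mem (ha q hq) (hb q hq)
  zero_mem' := by
    intro q _
    rw [map_zero, zero_mul]
    exact zero_mem _
  smul_mem' := by
    intro c a ha q hq
    rw [smul_eq_mul, map_mul, mul_assoc]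
    exact mul_mem ⟨c, rfl⟩ (ha q hq)

/-- A point of the normalization of `C` above `x`, given by its local ring: a valuation ring `V` of
the function field of an irreducible component through `x`, which dominates the local ring at `x`.
(For a curve and a closed point `x`, these are the localizations at the maximal ideals of the
integral closure of the local ring at `x`.) -/
structure Branch (C : Over (Spec (CommRingCat.of k))) (x : C.left) where
  /-- the generic point of the component -/
  pt : genericPoints C.left
  specializes : (pt : C.left) ⤳ x
  /-- the local ring of the normalization -/
  V : ValuationSubring (FunField C pt)
  map_mem : ∀ a : LocRing C x, toFunField C specializes a ∈ V
  map_nonunit : ∀ a ∈ IsLocalRing.maximalIdeal (LocRing C x),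
    toFunField C specializes a ∈ V.nonunits

/-! ## Meromorphic differentials on the normalization -/

/-- Meromorphic differentials on the normalization of `C`: a family of Kähler differentials of the
function fields of the irreducible components. -/
abbrev MeroForms (C : Over (Spec (CommRingCat.of k))) : Type u :=
  ∀ ξ : genericPoints C.left, Ω[FunField C ξ⁄k]

/-- For a function `f` in the local ring at `x` and a point `P` of the normalization above `x`, the
map which sends a meromorphic differential `η` to the germ of `f η` at `P`. -/
def germMul {C : Over (Spec (CommRingCat.of k))} {x : C.left} (f : LocRing C x) (P : Branch C x) :
    MeroForms C →ₗ[k] Ω[FunField C P.pt⁄k] :=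
  (Algebra.lsmul k k (Ω[FunField C P.pt⁄k]) (toFunField C P.specializes f)).comp
    (LinearMap.proj P.pt)

/-- The residue of a meromorphic differential at a point of the normalization. -/
def res {C : Over (Spec (CommRingCat.of k))} {x : C.left} (P : Branch C x) :
    MeroForms C →ₗ[k] k :=
  (residue k P.V).comp (LinearMap.proj P.pt)

/-- `η` has at most a simple pole at `P`. -/
def HasAtMostSimplePole {C : Over (Spec (CommRingCat.of k))} {x : C.left} (P : Branch C x)
    (η : MeroForms C) : Prop :=
  ∀ t ∈ P.V.nonunits, t • η P.pt ∈ regularForms k P.V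

/-- The residue pairing at `x`: `η ↦ ∑ Res_P (f η)`, the sum over the points `P` of the
normalization above `x`. -/
def resPairing {C : Over (Spec (CommRingCat.of k))} (x : C.left) (f : LocRing C x) :
    MeroForms C →ₗ[k] k :=
  ∑ᶠ P : Branch C x, (residue k P.V).comp (germMul f P)

/-- Meromorphic differentials regular at all points of the normalization above `x`. -/
def regularAt (C : Over (Spec (CommRingCat.of k))) (x : C.left) : Submodule k (MeroForms C) :=
  ⨅ P : Branch C x, (regularForms k P.V).comap (LinearMap.proj P.pt)

/-- Meromorphic differentials with allowed poles at `x`, i.e. whose principal parts above `x` are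
annihilated by the conductor: `f η` is regular above `x` for every `f` in the conductor. -/
def allowedAt (C : Over (Spec (CommRingCat.of k))) (x : C.left) : Submodule k (MeroForms C) :=
  ⨅ f ∈ conductor C x, ⨅ P : Branch C x, (regularForms k P.V).comap (germMul f P)

/-- Conductor-level balancing at `x`: the principal parts are annihilated by the conductor `𝔠`, and
they are orthogonal to `O` (equivalently, to the finite-dimensional space `O / 𝔠`) under the
residue pairing. -/
def balancedAt (C : Over (Spec (CommRingCat.of k))) (x : C.left) : Submodule k (MeroForms C) :=
  allowedAt C x ⊓ ⨅ f : LocRing C x, LinearMap.ker (resPairing x f)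

/-- The stalk at the closed point `x` of the dualizing sheaf of a reduced curve, as the sheaf of
regular differentials of Rosenlicht and Serre: the meromorphic differentials `η` on the
normalization with `∑ Res_P (f η) = 0` for all `f` in the local ring at `x`. -/
def dualizingAt (C : Over (Spec (CommRingCat.of k))) (x : C.left) : Submodule k (MeroForms C) :=
  ⨅ f : LocRing C x, LinearMap.ker (resPairing x f)

/-! ## Global sections and maximal variation -/

/-- The closed points of `C`. -/
abbrev ClosedPt (C : Over (Spec (CommRingCat.of k))) : Type u :=
  {x : C.left // IsClosed ({x} : Set C.left)}

/-- `H⁰(C, ω_C)`. -/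
def canonicalForms (C : Over (Spec (CommRingCat.of k))) : Submodule k (MeroForms C) :=
  ⨅ x : ClosedPt C, dualizingAt C x.1

/-- `H⁰(C~, ω_{C~}(allowed poles))`; at a closed point where `C` is normal the conductor is the unit
ideal and no pole is allowed. -/
def allowedForms (C : Over (Spec (CommRingCat.of k))) : Submodule k (MeroForms C) :=
  ⨅ x : ClosedPt C, allowedAt C x.1

/-- The meromorphic differentials satisfying conductor-level balancing at all points. -/
def balancedForms (C : Over (Spec (CommRingCat.of k))) : Submodule k (MeroForms C) :=
  ⨅ x : ClosedPt C, balancedAt C x.1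

/-- All conductor constraints, as one linear map on the differentials with allowed poles. Its rank
is the number of (linearly independent) conductor constraints. -/
def conductorConstraints (C : Over (Spec (CommRingCat.of k))) :
    allowedForms C →ₗ[k] (∀ x : ClosedPt C, LocRing C x.1 → k) :=
  LinearMap.pi fun x => LinearMap.pi fun f => (resPairing x.1 f).comp (allowedForms C).subtype

/-- Maximal variation. -/
structure MaximalVariation (C : Over (Spec (CommRingCat.of k))) : Prop where
  /-- every section of `ω_C` is a meromorphic differential with conductor-level balancing -/
  arises : canonicalForms C ≤ balancedForms C
  /-- there are no further constraints -/
  no_more : balancedForms C ≤ canonicalForms C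
  /-- `dim H⁰(C, ω_C) = dim H⁰(C~, ω_{C~}(allowed poles)) - (number of conductor constraints)` -/
  dim_eq : Module.rank k (canonicalForms C) +
      Module.rank k (LinearMap.range (conductorConstraints C)) = Module.rank k (allowedForms C)

/-! ## Nodal curves and stable curves -/

/-- A closed point at which the local ring is regular of dimension one. -/
def IsSmoothPt (C : Over (Spec (CommRingCat.of k))) (x : C.left) : Prop :=
  IsClosed ({x} : Set C.left) ∧ ∃ _ : IsDomain (LocRing C x), IsDiscreteValuationRing (LocRing C x)

/-- A node: a closed point whose completed local ring is `k[[X, Y]] / (X Y)`. -/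
def IsNode (C : Over (Spec (CommRingCat.of k))) (x : C.left) : Prop :=
  IsClosed ({x} : Set C.left) ∧
    Nonempty (AdicCompletion (IsLocalRing.maximalIdeal (LocRing C x)) (LocRing C x) ≃ₐ[k]
      (MvPowerSeries (Fin 2) k ⧸
        Ideal.span {(MvPowerSeries.X 0 * MvPowerSeries.X 1 : MvPowerSeries (Fin 2) k)}))

/-- A nodal curve: a reduced proper `k`-scheme, all of whose closed points are smooth points of
dimension one or nodes. -/
structure IsNodalCurve (C : Over (Spec (CommRingCat.of k))) : Prop where
  proper : IsProper C.hom
  reduced : IsReduced C.left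
  smooth_or_node : ∀ x : C.left, IsClosed ({x} : Set C.left) → IsSmoothPt C x ∨ IsNode C x

/-! ### Arithmetic genus and stable pointed curves -/

theorem toFunField_algebraMap (C : Over (Spec (CommRingCat.of k))) {ξ x : C.left} (h : ξ ⤳ x)
    (c : k) : toFunField C h (algebraMap k (LocRing C x) c) = algebraMap k (FunField C ξ) c := by
  have key : ∀ (y : C.left) (h : ξ ⤳ y),
      C.left.presheaf.germ ⊤ y trivial ≫ C.left.presheaf.stalkSpecializes h =
        C.left.presheaf.germ ⊤ ξ trivial :=
    fun y h => TopCat.Presheaf.germ_stalkSpecializes C.left.presheaf _ h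
  have e : ((Scheme.ΓSpecIso (CommRingCat.of k)).inv ≫ C.hom.appTop ≫
      C.left.presheaf.germ ⊤ x trivial) ≫ C.left.presheaf.stalkSpecializes h ≫ C.left.residue ξ =
      ((Scheme.ΓSpecIso (CommRingCat.of k)).inv ≫ C.hom.appTop ≫
      C.left.presheaf.germ ⊤ ξ trivial) ≫
        C.left.presheaf.stalkSpecializes (specializes_refl ξ) ≫ C.left.residue ξ := by
    simp only [Category.assoc, ← key x h]
    simp
  exact congrArg (fun φ => CommRingCat.Hom.hom φ c) e

/-- The local ring at `x` inside the rational functions near `x`, as a `k`-subspace. -/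
def integralAt (C : Over (Spec (CommRingCat.of k))) (x : C.left) : Submodule k (RatAt C x) where
  carrier := (toRatAt C x).range
  add_mem' := fun ha hb => add_mem ha hb
  zero_mem' := zero_mem _
  smul_mem' := by
    rintro c _ ⟨a, rfl⟩
    refine ⟨algebraMap k (LocRing C x) c * a, ?_⟩
    funext ξ
    rw [map_mul, Pi.mul_apply, Pi.smul_apply, Algebra.smul_def]
    congr 1
    exact toFunField_algebraMap C ξ.2 c

/-- Families of rational functions at the closed points, almost all of which lie in the local ring
at the point. -/
def adeles (C : Over (Spec (CommRingCat.of k))) :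
    Submodule k (∀ x : ClosedPt C, RatAt C x.1) where
  carrier := {r | {x | r x ∉ integralAt C x.1}.Finite}
  add_mem' := fun {r s} hr hs => (Set.Finite.union hr hs).subset fun x hx => by
    by_contra h
    have h1 : r x ∈ integralAt C x.1 := by_contra fun h1 => h (Or.inl h1)
    have h2 : s x ∈ integralAt C x.1 := by_contra fun h2 => h (Or.inr h2)
    exact hx (add_mem h1 h2)
  zero_mem' := Set.finite_empty.subset fun x hx => hx (zero_mem (integralAt C x.1))
  smul_mem' := fun c _ hr => Set.Finite.subset hr fun x hx h =>
    hx ((integralAt C x.1).smul_mem c h)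

/-- The diagonal map from the rational functions on `C`. -/
def diagonal (C : Over (Spec (CommRingCat.of k))) :
    (∀ ξ : genericPoints C.left, FunField C ξ) →ₗ[k] (∀ x : ClosedPt C, RatAt C x.1) :=
  LinearMap.pi fun _ => LinearMap.pi fun ξ => LinearMap.proj ξ.1

/-- The arithmetic genus `dim H¹(C, O_C)` of a connected reduced curve, where `H¹(C, O_C)` is the
cokernel of (rational functions) → `⨁ x, (rational functions at x) / O_x`, computed by the flasque
resolution of `O_C` by the sheaf of rational functions and its quotient. -/
def arithmeticGenus (C : Over (Spec (CommRingCat.of k))) : ℕ :=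
  Module.finrank k (adeles C ⧸ Submodule.comap (adeles C).subtype
    (LinearMap.range (diagonal C) ⊔ Submodule.pi Set.univ fun x : ClosedPt C => integralAt C x.1))

/-- Stable `n`-pointed curves of genus `g` over `k`: connected nodal curves of arithmetic genus `g`
with `n` distinct smooth marked points and finitely many automorphisms. -/
structure StableCurve (k : Type u) [Field k] (g n : ℕ) where
  curve : Over (Spec (CommRingCat.of k))
  nodal : IsNodalCurve curve
  connected : ConnectedSpace curve.left
  genus : arithmeticGenus curve = g
  mark : Fin n → curve.left
  mark_injective : Function.Injective mark
  mark_smooth : ∀ i, IsSmoothPt curve (mark i)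
  finite_aut : Finite {σ : curve ≅ curve // ∀ i, σ.hom.left (mark i) = mark i}

/-- The maximal-variation locus, on `k`-points of the moduli stack of stable curves. -/
def mvLocus (k : Type u) [Field k] (g n : ℕ) : Set (StableCurve k g n) :=
  {S | MaximalVariation S.curve}

end

end NodalMV

namespace NodalMV

noncomputable section

/-! ## Residues at rational discrete places -/

section RationalPlace

open KaehlerDifferential

variable (k : Type u) [Field k] {K : Type u} [Field K] [Algebra k K]

/-! At a node the argument stays in the local ring O, with maximal ideal m. The isomorphism with
k[[X,Y]]/(XY) is read modulo m³, giving x, y ∈ m with xy ∈ m³. The whole completion is used only to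
see that m is not principal, since otherwise it would be a domain; so x, y are a basis of m/m²
(`exists_isNodePair`). Put z = x + y. From x² = zx − xy, y² = zy − xy and Nakayama, m² = zm
(`IsNodePair.sq_eq`). Hence xy = z²c with c ∈ m, and e = x/z satisfies e² − e + c = 0: it is
integral over O and idempotent modulo m. A place dominating O therefore has exactly one of x/z, y/z
in its maximal ideal. Each alternative occurs for exactly one place, with uniformizer z and residue
field k; these are P and Q (`IsNode.exists_nodeData`). Multiplication by z carries functions regular
at P and Q into m, so m lies in the conductor; equality holds because e is integral but not in O
(`NodeData.conductor_eq`).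

At such a place Ω = K dt, the regular forms are V dt, and ω is regular as soon as Res(vω) = 0 for
all v ∈ V. If η is a regular differential in Rosenlicht's sense, its pairing is tested on functions
dp with d = z(y/z)^M ∈ O: at Q this kills the pole of η, at P it is z times a unit. Since O
approximates the place ring at P to any order, all residues of vzη at P vanish, so the pole at P is
at most simple (`NodeData.hasAtMostSimplePole_of_dualizing`). For simple poles the pairing depends
only on f modulo m, and the one surviving condition is Res_P η + Res_Q η = 0.

At a smooth point there is at most one place, and the same approximation excludes poles. Thus
descending forms have allowed poles everywhere, balanced and canonical forms coincide, and the
canonical forms are the kernel of all constraints on the allowed forms: the dimension formula is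
rank-nullity. -/

/-- The valuation ring `V` is discrete with residue field `k`, and its differentials are finitely
generated. -/
structure IsRationalPlace (V : ValuationSubring K) : Prop where
  algebraMap_mem : ∀ c : k, V.valuation (algebraMap k K c) ≤ 1
  exists_const : ∀ g, V.valuation g ≤ 1 → ∃ c : k, V.valuation (g - algebraMap k K c) < 1
  exists_uniformizer : ∃ z, V.valuation z < 1 ∧ z ≠ 0 ∧
    ∀ g, g ≠ 0 → ∃ n : ℤ, V.valuation g = V.valuation z ^ n
  fg : (Submodule.span V (D k K '' (V : Set K))).FG
  nontrivial : Nontrivial (Ω[K⁄k])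

/-- `t` generates the value group of `V`. -/
structure IsUniformizer (V : ValuationSubring K) (t : K) : Prop where
  lt_one : V.valuation t < 1
  ne_zero : t ≠ 0
  exists_zpow : ∀ g, g ≠ 0 → ∃ n : ℤ, V.valuation g = V.valuation t ^ n

variable {k} {V : ValuationSubring K} {t : K}

theorem IsUniformizer.pos (ht : IsUniformizer V t) : 0 < V.valuation t :=
  zero_lt_iff.2 ((Valuation.ne_zero_iff _).2 ht.ne_zero)

theorem IsUniformizer.le_of_lt_one (ht : IsUniformizer V t) {g : K} (hg : V.valuation g < 1) :
    V.valuation g ≤ V.valuation t := by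
  by_cases h0 : g = 0
  · simp [h0]
  obtain ⟨n, hn⟩ := ht.exists_zpow g h0
  rw [hn, zpow_lt_one_iff_right_of_lt_one₀ ht.pos ht.lt_one] at hg
  rw [hn]
  conv_rhs => rw [← zpow_one (V.valuation t)]
  rw [zpow_le_zpow_iff_right_of_lt_one₀ ht.pos ht.lt_one]
  lia

theorem IsUniformizer.div_le (ht : IsUniformizer V t) {g : K} (hg : V.valuation g < 1) :
    V.valuation (g / t) ≤ 1 := by
  rw [map_div₀]
  exact div_le_one_of_le₀ (ht.le_of_lt_one hg) zero_le

theorem IsUniformizer.of_valuation_eq (ht : IsUniformizer V t) {s : K}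
    (h : V.valuation s = V.valuation t) : IsUniformizer V s where
  lt_one := h ▸ ht.lt_one
  ne_zero := (Valuation.ne_zero_iff V.valuation).1 (h ▸ ht.pos.ne')
  exists_zpow := h ▸ ht.exists_zpow

/-- The definition `IsResidue` supplies only an irreducible element; this turns it into a generator
of the value group, as t divides s and the cofactor must be a unit. -/
theorem IsUniformizer.of_irreducible (ht : IsUniformizer V t) {s : V} (hs : Irreducible s) :
    IsUniformizer V (s : K) := by
  have h1 : V.valuation (s : K) < 1 := (V.valuation_lt_one_iff s).1 hs.not_isUnit
  have ht' : t ∈ V := (V.valuation_le_one_iff t).1 ht.lt_one.le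
  have h2 : (s : K) / t ∈ V := (V.valuation_le_one_iff _).1 (ht.div_le h1)
  have h3 : s = ⟨t, ht'⟩ * ⟨_, h2⟩ := by
    ext
    simp only [MulMemClass.mk_mul_mk]
    field_simp [ht.ne_zero]
  rcases hs.isUnit_or_isUnit h3 with h | h
  · exact absurd ((V.valuation_eq_one_iff _).1 h) ht.lt_one.ne
  · refine ht.of_valuation_eq ?_
    have h4 := (V.valuation_eq_one_iff _).1 h
    rw [h3]
    simpa using congrArg (V.valuation t * ·) h4

theorem IsUniformizer.irreducible (ht : IsUniformizer V t) :
    Irreducible (⟨t, (V.valuation_le_one_iff t).1 ht.lt_one.le⟩ : V) := by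
  refine ⟨fun h => ht.lt_one.ne ((V.valuation_eq_one_iff _).1 h), ?_⟩
  intro a b hab
  by_contra! h
  have ha := ht.le_of_lt_one ((V.valuation_lt_one_iff a).1 h.1)
  have hb := (V.valuation_lt_one_iff b).1 h.2
  have hab' : V.valuation t = V.valuation a * V.valuation b := by
    rw [← map_mul]
    exact congrArg (fun x : V => V.valuation (x : K)) hab
  have : V.valuation t < V.valuation t := by
    conv_lhs => rw [hab']
    calc V.valuation a * V.valuation b ≤ V.valuation t * V.valuation b := by gcongr
      _ < V.valuation t * 1 := mul_lt_mul_of_pos_left hb ht.pos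
      _ = _ := mul_one _
  exact this.false

theorem smul_mem_span (ω : Ω[K⁄k]) {N : Submodule V (Ω[K⁄k])} (hω : ω ∈ N) {v : K}
    (hv : V.valuation v ≤ 1) : v • ω ∈ N :=
  N.smul_mem (⟨v, (V.valuation_le_one_iff v).1 hv⟩ : V) hω

/-- The regular forms are the multiples of `dt` by elements of `V`. -/
theorem IsRationalPlace.span_eq (hV : IsRationalPlace k V) (ht : IsUniformizer V t) :
    Submodule.span V (D k K '' (V : Set K)) = Submodule.span V {D k K t} := by
  have htV : t ∈ V := (V.valuation_le_one_iff t).1 ht.lt_one.le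
  apply le_antisymm
  · refine Submodule.le_of_le_smul_of_le_jacobson_bot (I := IsLocalRing.maximalIdeal V) hV.fg
      (IsLocalRing.maximalIdeal_le_jacobson _) ?_
    rw [Submodule.span_le]
    rintro _ ⟨v, hv, rfl⟩
    -- Write v = c + tg, so dv = g dt + t dg. The last term lies in the maximal ideal times the
    -- module, and Nakayama discards it; this is what the field `fg` is for.
    obtain ⟨c, hc⟩ := hV.exists_const v ((V.valuation_le_one_iff v).2 hv)
    have hg := ht.div_le hc
    set g := (v - algebraMap k K c) / t with hgdef
    have hgV : g ∈ V := (V.valuation_le_one_iff g).1 hg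
    have hv' : v = algebraMap k K c + t * g := by
      rw [hgdef]; field_simp [ht.ne_zero]; ring
    have : D k K v = g • D k K t + t • D k K g := by
      rw [hv', map_add, Derivation.map_algebraMap, zero_add, Derivation.leibniz, add_comm]
    rw [SetLike.mem_coe, this]
    refine Submodule.add_mem_sup ?_ ?_
    · exact smul_mem_span _ (Submodule.mem_span_singleton_self _) hg
    · exact Submodule.smul_mem_smul (r := (⟨t, htV⟩ : V))
        ((V.valuation_lt_one_iff _).2 ht.lt_one) (Submodule.subset_span ⟨g, hgV, rfl⟩)
  · rw [Submodule.span_singleton_le_iff_mem]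
    exact Submodule.subset_span ⟨t, htV, rfl⟩

theorem IsRationalPlace.mem_regularForms (hV : IsRationalPlace k V) (ht : IsUniformizer V t)
    {ω : Ω[K⁄k]} : ω ∈ regularForms k V ↔ ∃ v, V.valuation v ≤ 1 ∧ ω = v • D k K t := by
  have htV : t ∈ V := (V.valuation_le_one_iff t).1 ht.lt_one.le
  constructor
  · intro h
    have h2 : ω ∈ Submodule.span V {D k K t} := by
      rw [← hV.span_eq ht]
      refine Submodule.span_induction ?_ (zero_mem _) (fun _ _ _ _ => add_mem) ?_ h
      · rintro _ ⟨v, hv, w, hw, rfl⟩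
        exact smul_mem_span _ (Submodule.subset_span (Set.mem_image_of_mem _ hw))
          ((V.valuation_le_one_iff v).2 hv)
      · intro c x _ hx
        rw [algebra_compatible_smul K c x]
        exact smul_mem_span _ hx (hV.algebraMap_mem c)
    obtain ⟨v, hv⟩ := Submodule.mem_span_singleton.1 h2
    exact ⟨(v : K), V.valuation_le_one v, hv.symm⟩
  · rintro ⟨v, hv, rfl⟩
    exact Submodule.subset_span ⟨v, (V.valuation_le_one_iff v).1 hv, t, htV, rfl⟩

theorem IsRationalPlace.smul_mem_regularForms (hV : IsRationalPlace k V) {ω : Ω[K⁄k]}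
    (hω : ω ∈ regularForms k V) {v : K} (hv : V.valuation v ≤ 1) : v • ω ∈ regularForms k V := by
  obtain ⟨z, h1, h2, h3⟩ := hV.exists_uniformizer
  have hz : IsUniformizer V z := ⟨h1, h2, h3⟩
  obtain ⟨w, hw, rfl⟩ := (hV.mem_regularForms hz).1 hω
  refine (hV.mem_regularForms hz).2 ⟨v * w, ?_, by rw [mul_smul]⟩
  rw [map_mul]
  exact mul_le_one' hv hw

theorem IsRationalPlace.exists_eq_smul (hV : IsRationalPlace k V) (ht : IsUniformizer V t)
    (ω : Ω[K⁄k]) : ∃ g : K, ω = g • D k K t := by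
  have key : ∀ v ∈ V, ∃ g : K, D k K v = g • D k K t := fun v hv => by
    have : D k K v ∈ Submodule.span V {D k K t} := by
      rw [← hV.span_eq ht]
      exact Submodule.subset_span ⟨v, hv, rfl⟩
    obtain ⟨g, hg⟩ := Submodule.mem_span_singleton.1 this
    exact ⟨g, hg.symm⟩
  have h : (⊤ : Submodule K (Ω[K⁄k])) ≤ Submodule.span K {D k K t} := by
    rw [← KaehlerDifferential.span_range_derivation, Submodule.span_le]
    rintro _ ⟨g, rfl⟩
    rw [SetLike.mem_coe, Submodule.mem_span_singleton]
    rcases V.mem_or_inv_mem g with hg | hg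
    · obtain ⟨a, ha⟩ := key g hg
      exact ⟨a, ha.symm⟩
    -- For g outside V use dg = −g² d(g⁻¹).
    · obtain ⟨a, ha⟩ := key _ hg
      refine ⟨-g ^ 2 * a, ?_⟩
      have := Derivation.leibniz_inv (D k K) g⁻¹
      rw [inv_inv] at this
      rw [this, ha, mul_smul]
  obtain ⟨g, hg⟩ := Submodule.mem_span_singleton.1 (h (Submodule.mem_top (x := ω)))
  exact ⟨g, hg.symm⟩

theorem IsRationalPlace.d_ne_zero (hV : IsRationalPlace k V) (ht : IsUniformizer V t) :
    D k K t ≠ 0 := by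
  intro h
  obtain ⟨ω, hω⟩ := @exists_ne _ hV.nontrivial (0 : Ω[K⁄k])
  obtain ⟨g, hg⟩ := hV.exists_eq_smul ht ω
  exact hω (by rw [hg, h, smul_zero])

/-- Multiplication by a high power of a nonunit makes every differential regular. -/
theorem IsRationalPlace.exists_pow_smul_mem (hV : IsRationalPlace k V) {s : K}
    (hs : V.valuation s < 1) (ω : Ω[K⁄k]) :
    ∃ N : ℕ, ∀ g, V.valuation g ≤ V.valuation s ^ N → g • ω ∈ regularForms k V := by
  obtain ⟨z, h1, h2, h3⟩ := hV.exists_uniformizer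
  have hz : IsUniformizer V z := ⟨h1, h2, h3⟩
  obtain ⟨f, rfl⟩ := hV.exists_eq_smul hz ω
  by_cases hf : f = 0
  · exact ⟨0, fun g _ => by simp [hf]⟩
  obtain ⟨n, hn⟩ := hz.exists_zpow f hf
  refine ⟨n.natAbs, fun g hg => (hV.mem_regularForms hz).2 ⟨g * f, ?_, by rw [mul_smul]⟩⟩
  have h4 : V.valuation g ≤ V.valuation z ^ n.natAbs :=
    hg.trans (pow_le_pow_left₀ zero_le (hz.le_of_lt_one hs) _)
  rw [map_mul, hn]
  calc _ ≤ V.valuation z ^ n.natAbs * V.valuation z ^ n := by gcongr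
    _ = V.valuation z ^ ((n.natAbs : ℤ) + n) := by
      rw [zpow_add₀ hz.pos.ne', zpow_natCast]
    _ ≤ 1 := by
      rw [zpow_le_one_iff_right_of_lt_one₀ hz.pos hz.lt_one]
      lia

/-- The polar terms `t ^ (-n)`, `n > 0`, are linearly independent modulo `V`. -/
theorem IsRationalPlace.eq_zero_of_sum (hV : IsRationalPlace k V) (ht : IsUniformizer V t) :
    ∀ (n : ℕ) (c : ℕ → k),
      V.valuation (∑ i ∈ Finset.range n, algebraMap k K (c i) * t⁻¹ ^ (i + 1)) ≤ 1 →
      ∀ i < n, c i = 0 := by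
  intro n
  induction n with
  | zero => intro c _ i hi; lia
  | succ n ih =>
    intro c h
    -- After multiplication by t^(n+1) the sum and all its lower terms have value < 1, whereas a
    -- nonzero top coefficient would have value 1.
    have hcn : c n = 0 := by
      by_contra hne
      have h1 : V.valuation (algebraMap k K (c n)) = 1 := by
        apply le_antisymm (hV.algebraMap_mem _)
        have := hV.algebraMap_mem (c n)⁻¹
        rw [map_inv₀, map_inv₀] at this
        exact (inv_le_one₀ (zero_lt_iff.2 (by simpa using hne))).1 this
      have h2 : V.valuation (t ^ (n + 1) *
          ∑ i ∈ Finset.range (n + 1), algebraMap k K (c i) * t⁻¹ ^ (i + 1)) < 1 := by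
        rw [map_mul]
        refine lt_of_le_of_lt (mul_le_of_le_one_right' h) ?_
        rw [map_pow]
        exact pow_lt_one₀ zero_le ht.lt_one (by lia)
      rw [Finset.sum_range_succ, mul_add] at h2
      have h3 : t ^ (n + 1) * (algebraMap k K (c n) * t⁻¹ ^ (n + 1)) = algebraMap k K (c n) := by
        rw [inv_pow]
        field_simp [ht.ne_zero]
      rw [h3] at h2
      have h4 : V.valuation (t ^ (n + 1) *
          ∑ i ∈ Finset.range n, algebraMap k K (c i) * t⁻¹ ^ (i + 1)) < 1 := by
        rw [Finset.mul_sum]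
        refine Valuation.map_sum_lt _ one_ne_zero fun i hi => ?_
        have hi' : i < n := Finset.mem_range.1 hi
        have : t ^ (n + 1) * (algebraMap k K (c i) * t⁻¹ ^ (i + 1)) =
            algebraMap k K (c i) * t ^ (n - i) := by
          have e : n + 1 = (n - i) + (i + 1) := by lia
          rw [e, pow_add, inv_pow]
          have := pow_ne_zero (i + 1) ht.ne_zero
          field_simp
        rw [this, map_mul, map_pow]
        exact lt_of_le_of_lt (mul_le_of_le_one_left' (hV.algebraMap_mem _))
          (pow_lt_one₀ zero_le ht.lt_one (by lia))
      have h5 := Valuation.map_sub_lt _ h2 h4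
      rw [add_sub_cancel_left, h1] at h5
      exact h5.false
    rw [Finset.sum_range_succ, hcn, map_zero, zero_mul, add_zero] at h
    intro i hi
    rcases Nat.lt_succ_iff_lt_or_eq.1 hi with h6 | rfl
    · exact ih c h i h6
    · exact hcn

/-- The polar terms stay independent in K/V, so their inclusion has a linear left inverse, and ρ is
its coefficient of t⁻¹. Off V plus the span of the polar terms the choice is arbitrary, and
harmless. -/
theorem IsRationalPlace.exists_functional (hV : IsRationalPlace k V) (ht : IsUniformizer V t) :
    ∃ ρ : K →ₗ[k] k, (∀ v, V.valuation v ≤ 1 → ρ v = 0) ∧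
      ∀ n : ℕ, ρ (t⁻¹ ^ (n + 1)) = if n = 0 then 1 else 0 := by
  let S : Submodule k K :=
    { carrier := {v | V.valuation v ≤ 1}
      add_mem' := fun {a b} (ha : V.valuation a ≤ 1) (hb : V.valuation b ≤ 1) =>
        (Valuation.map_add_le _ ha hb : V.valuation (a + b) ≤ 1)
      zero_mem' := by simp
      smul_mem' := fun c v (hv : V.valuation v ≤ 1) => show V.valuation (c • v) ≤ 1 by
        rw [Algebra.smul_def, map_mul]
        exact mul_le_one' (hV.algebraMap_mem c) hv }
  let f : (ℕ →₀ k) →ₗ[k] K ⧸ S :=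
    S.mkQ.comp (Finsupp.linearCombination k fun n : ℕ => t⁻¹ ^ (n + 1))
  have hf : LinearMap.ker f = ⊥ := by
    rw [LinearMap.ker_eq_bot']
    intro c hc
    have h1 : Finsupp.linearCombination k (fun n : ℕ => t⁻¹ ^ (n + 1)) c ∈ S := by
      rwa [LinearMap.comp_apply, Submodule.mkQ_apply, Submodule.Quotient.mk_eq_zero] at hc
    obtain ⟨n, hn⟩ := c.support.exists_nat_subset_range
    rw [Finsupp.linearCombination_apply, Finsupp.sum_of_support_subset c hn _ (by simp)] at h1
    have h2 := hV.eq_zero_of_sum ht n c (by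
      simp only [← Algebra.smul_def]
      exact h1)
    ext i
    by_cases hi : i < n
    · exact h2 i hi
    · by_contra hne
      exact hi (Finset.mem_range.1 (hn (Finsupp.mem_support_iff.2 hne)))
  obtain ⟨g, hg⟩ := LinearMap.exists_leftInverse_of_injective f hf
  refine ⟨(Finsupp.lapply 0).comp (g.comp S.mkQ), ?_, ?_⟩
  · intro v hv
    have : S.mkQ v = 0 := (Submodule.Quotient.mk_eq_zero S).2 hv
    simp only [LinearMap.comp_apply, this, map_zero]
  · intro n
    have h1 : S.mkQ (t⁻¹ ^ (n + 1)) = f (Finsupp.single n 1) := by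
      simp [f]
    have h2 := LinearMap.congr_fun hg (Finsupp.single n 1)
    rw [LinearMap.comp_apply, LinearMap.id_apply] at h2
    rw [LinearMap.comp_apply, LinearMap.comp_apply, h1, h2, Finsupp.lapply_apply,
      Finsupp.single_apply]

theorem IsRationalPlace.exists_isResidue (hV : IsRationalPlace k V) :
    ∃ r, IsResidue k V r := by
  obtain ⟨t, h1, h2, h3⟩ := hV.exists_uniformizer
  have ht : IsUniformizer V t := ⟨h1, h2, h3⟩
  obtain ⟨ρ, hρ, hρt⟩ := hV.exists_functional ht
  have hinj : Function.Injective (LinearMap.toSpanSingleton K (Ω[K⁄k]) (D k K t)) := by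
    intro a b hab
    exact smul_left_injective K (hV.d_ne_zero ht) hab
  have hsurj : Function.Surjective (LinearMap.toSpanSingleton K (Ω[K⁄k]) (D k K t)) := by
    intro ω
    obtain ⟨g, hg⟩ := hV.exists_eq_smul ht ω
    exact ⟨g, hg.symm⟩
  let e := LinearEquiv.ofBijective _ ⟨hinj, hsurj⟩
  have he : ∀ g : K, e.symm (g • D k K t) = g := fun g =>
    e.symm_apply_eq.2 rfl
  refine ⟨ρ.comp (e.symm.toLinearMap.restrictScalars k), _, ht.irreducible, ?_, ?_⟩
  · intro ω hω
    obtain ⟨v, hv, rfl⟩ := (hV.mem_regularForms ht).1 hω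
    simpa [he] using hρ v hv
  · intro n
    simpa [he] using hρt n

/-- At a rational place `residue` is not its default value 0. Afterwards only the clauses of
`IsResidue`, for one unspecified uniformizer, are used, so independence of the uniformizer is never
needed. -/
theorem IsRationalPlace.isResidue (hV : IsRationalPlace k V) : IsResidue k V (residue k V) := by
  have h := hV.exists_isResidue
  rw [residue, dif_pos h]
  exact h.choose_spec

theorem IsRationalPlace.residue_eq_zero (hV : IsRationalPlace k V) {ω : Ω[K⁄k]}
    (hω : ω ∈ regularForms k V) : residue k V ω = 0 := by
  obtain ⟨t, _, h, _⟩ := hV.isResidue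
  exact h ω hω

/-- A differential all of whose multiples by elements of `V` have no residue is regular. -/
theorem IsRationalPlace.mem_regularForms_of_residue (hV : IsRationalPlace k V) {ω : Ω[K⁄k]}
    (h : ∀ v, V.valuation v ≤ 1 → residue k V (v • ω) = 0) : ω ∈ regularForms k V := by
  obtain ⟨t, hirr, -, ht1⟩ := hV.isResidue
  obtain ⟨z, h1, h2, h3⟩ := hV.exists_uniformizer
  have ht : IsUniformizer V (t : K) := IsUniformizer.of_irreducible ⟨h1, h2, h3⟩ hirr
  obtain ⟨g, rfl⟩ := hV.exists_eq_smul ht ω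
  refine (hV.mem_regularForms ht).2 ⟨g, ?_, rfl⟩
  by_contra hg
  rw [not_le] at hg
  have hg0 : g ≠ 0 := by rintro rfl; simp at hg
  have hg' : V.valuation g⁻¹ < 1 := by
    rw [map_inv₀]
    exact inv_lt_one_of_one_lt₀ hg
  -- If g is not in V, then v = g⁻¹/t is in V and turns g dt into dt/t, whose residue is 1.
  have h5 := h (g⁻¹ / t) (ht.div_le hg')
  have h6 := ht1 0
  rw [smul_smul, div_mul_eq_mul_div, inv_mul_cancel₀ hg0, one_div] at h5
  simp only [zero_add, pow_one, if_true] at h6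
  exact one_ne_zero (h6.symm.trans h5)

/-- There is a differential with a simple pole and residue `1`. -/
theorem IsRationalPlace.exists_simple_pole (hV : IsRationalPlace k V) :
    ∃ ω : Ω[K⁄k], (∀ s ∈ V.nonunits, s • ω ∈ regularForms k V) ∧ residue k V ω = 1 := by
  obtain ⟨t, hirr, -, ht1⟩ := hV.isResidue
  obtain ⟨z, h1, h2, h3⟩ := hV.exists_uniformizer
  have ht : IsUniformizer V (t : K) := IsUniformizer.of_irreducible ⟨h1, h2, h3⟩ hirr
  refine ⟨(t : K)⁻¹ • D k K (t : K), fun s hs => ?_, by simpa using ht1 0⟩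
  refine (hV.mem_regularForms ht).2 ⟨s / t, ht.div_le (V.mem_nonunits_iff.1 hs), ?_⟩
  rw [smul_smul, div_eq_mul_inv]

/-- Write gω = cω + (g − c)ω; the last form is regular because g − c cancels the simple pole. -/
theorem IsRationalPlace.residue_smul_of_simple_pole (hV : IsRationalPlace k V) {ω : Ω[K⁄k]}
    (hω : ∀ s ∈ V.nonunits, s • ω ∈ regularForms k V) {g : K} {c : k}
    (hg : V.valuation (g - algebraMap k K c) < 1) :
    residue k V (g • ω) = c * residue k V ω := by
  have h := hV.residue_eq_zero (hω _ (V.mem_nonunits_iff.2 hg))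
  rw [sub_smul, algebraMap_smul, map_sub, sub_eq_zero] at h
  rw [h, map_smul, smul_eq_mul]

theorem IsRationalPlace.mem_regularForms_of_simple_pole (hV : IsRationalPlace k V) {ω : Ω[K⁄k]}
    (hω : ∀ s ∈ V.nonunits, s • ω ∈ regularForms k V) (h : residue k V ω = 0) :
    ω ∈ regularForms k V := by
  refine hV.mem_regularForms_of_residue fun v hv => ?_
  obtain ⟨c, hc⟩ := hV.exists_const v hv
  rw [hV.residue_smul_of_simple_pole hω hc, h, mul_zero]

end RationalPlace

/-! ### Recognizing rational places from a subalgebra -/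

section RationalPlace

open KaehlerDifferential

variable {k : Type u} [Field k] {K : Type u} [Field K] [Algebra k K] {V : ValuationSubring K}
  {S : Subalgebra k K}

theorem mem_of_mem_span_of_valuation_le_one {A M : Type*} [CommRing A] [Algebra A K]
    [AddCommGroup M] [Module K M] [Module V M] [IsScalarTower V K M] [Module A M]
    [IsScalarTower A K M] (hA : ∀ a : A, V.valuation (algebraMap A K a) ≤ 1)
    {F : Set M} {N : Submodule V M} (hF : F ⊆ N) {ω : M} (hω : ω ∈ Submodule.span A F) :
    ω ∈ N := by
  refine Submodule.span_induction (fun x hx => hF hx) (zero_mem _) (fun _ _ _ _ => add_mem) ?_ hω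
  intro s x _ hx
  rw [algebra_compatible_smul K s x]
  have h := N.smul_mem (⟨_, (V.valuation_le_one_iff _).1 (hA s)⟩ : V) hx
  rwa [algebra_compatible_smul K] at h

/-- The differentials of `V` are generated by those of a subalgebra, if `V` is obtained from it by
inverting units. -/
theorem span_D_fg [Algebra.EssFiniteType k S] (hSV : ∀ s ∈ S, V.valuation s ≤ 1)
    {z : K} (hzS : z ∈ S)
    (hfrac : ∀ g ∈ V, g ≠ 0 → ∃ n : ℕ, ∃ p ∈ S, ∃ q ∈ S, V.valuation p = 1 ∧ V.valuation q = 1 ∧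
      g = z ^ n * (p / q)) :
    (Submodule.span V (D k K '' (V : Set K))).FG := by
  obtain ⟨F, hF⟩ : (LinearMap.range (KaehlerDifferential.map k k S K)).FG :=
    LinearMap.range_eq_map (KaehlerDifferential.map k k S K) ▸ Module.Finite.fg_top.map _
  have hDS : ∀ s ∈ S, D k K s ∈ Submodule.span V (F : Set (Ω[K⁄k])) := by
    intro s hs
    exact mem_of_mem_span_of_valuation_le_one (A := S) (fun s => hSV s s.2) Submodule.subset_span
      (hF ▸ ⟨D k S ⟨s, hs⟩, KaehlerDifferential.map_D k k S K _⟩)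
  refine ⟨F, le_antisymm ?_ ?_⟩
  · rw [Submodule.span_le]
    intro ω hω
    have h1 : ω ∈ LinearMap.range (KaehlerDifferential.map k k S K) := by
      rw [← hF]; exact Submodule.subset_span hω
    obtain ⟨ω', rfl⟩ := h1
    have h2 : ω' ∈ Submodule.span S (Set.range (D k S)) := by
      rw [KaehlerDifferential.span_range_derivation]; trivial
    have h3 := Submodule.mem_map_of_mem (f := KaehlerDifferential.map k k S K) h2
    rw [Submodule.map_span] at h3
    refine mem_of_mem_span_of_valuation_le_one (A := S) (fun s => hSV s s.2) ?_ h3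
    rintro _ ⟨_, ⟨s, rfl⟩, rfl⟩
    rw [KaehlerDifferential.map_D]
    exact Submodule.subset_span ⟨_, (V.valuation_le_one_iff _).1 (hSV s s.2), rfl⟩
  · rw [Submodule.span_le]
    rintro _ ⟨g, hg, rfl⟩
    by_cases h0 : g = 0
    · simp [h0]
    obtain ⟨n, p, hp, q, hq, hp1, hq1, rfl⟩ := hfrac g hg h0
    have hz := hSV z hzS
    have hq' : V.valuation q⁻¹ ≤ 1 := by rw [map_inv₀, hq1, inv_one]
    have hpq : V.valuation (p / q) ≤ 1 := by rw [map_div₀, hp1, hq1, div_one]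
    have hzn : ∀ m : ℕ, V.valuation (z ^ m) ≤ 1 := fun m => by
      rw [map_pow]; exact pow_le_one₀ zero_le hz
    rw [SetLike.mem_coe, Derivation.leibniz, Derivation.leibniz_pow, div_eq_mul_inv,
      Derivation.leibniz, Derivation.leibniz_inv]
    refine add_mem (smul_mem_span _ (add_mem (smul_mem_span _ ?_ hp1.le)
      (smul_mem_span _ (hDS p hp) hq')) (hzn _)) ?_
    · refine smul_mem_span _ (hDS q hq) ?_
      rw [Valuation.map_neg, map_pow, map_inv₀, hq1, inv_one, one_pow]
    · rw [← div_eq_mul_inv]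
      exact smul_mem_span _ (nsmul_mem (smul_mem_span _ (hDS z hzS) (hzn _)) _) hpq

theorem exists_const_of_subalgebra (hSV : ∀ s ∈ S, V.valuation s ≤ 1)
    (hconst : ∀ s ∈ S, ∃ c : k, V.valuation (s - algebraMap k K c) < 1)
    {p q : K} (hp : p ∈ S) (hq : q ∈ S) (hq1 : V.valuation q = 1) :
    ∃ c : k, V.valuation (p / q - algebraMap k K c) < 1 := by
  obtain ⟨c, hc⟩ := hconst p hp
  obtain ⟨d, hd⟩ := hconst q hq
  have hk : ∀ c : k, V.valuation (algebraMap k K c) ≤ 1 := fun c => hSV _ (S.algebraMap_mem c)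
  have hd0 : d ≠ 0 := by
    rintro rfl
    rw [map_zero, sub_zero, hq1] at hd
    exact hd.false
  have hd0' : algebraMap k K d ≠ 0 := by simpa using hd0
  have hq0 : q ≠ 0 := by
    rintro rfl
    simp at hq1
  refine ⟨c / d, ?_⟩
  have e : p / q - algebraMap k K (c / d) =
      ((p - algebraMap k K c) - algebraMap k K (c / d) * (q - algebraMap k K d)) / q := by
    rw [map_div₀]
    field_simp
    ring
  rw [e, map_div₀, hq1, div_one]
  refine Valuation.map_sub_lt _ hc ?_
  rw [map_mul]
  exact lt_of_le_of_lt (mul_le_of_le_one_left' (hk _)) hd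

/-- If Ω vanished, K would be unramified over k, hence separable algebraic, hence equal to k; but a
nonzero constant has value 1, unlike z. -/
theorem nontrivial_kaehlerDifferential [IsAlgClosed k] [CharZero k] [Algebra.EssFiniteType k K]
    (hk : ∀ c : k, V.valuation (algebraMap k K c) ≤ 1) {z : K} (hz : V.valuation z < 1)
    (hz0 : z ≠ 0) : Nontrivial (Ω[K⁄k]) := by
  by_contra h
  rw [not_nontrivial_iff_subsingleton] at h
  have h1 : Algebra.FormallyUnramified k K := ⟨h⟩
  have h2 : Algebra.IsSeparable k K := (Algebra.FormallyUnramified.iff_isSeparable k K).1 h1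
  obtain ⟨c, rfl⟩ := IsAlgClosed.algebraMap_bijective_of_isIntegral (k := k) (K := K) |>.2 z
  have h3 := hk c⁻¹
  rw [map_inv₀, map_inv₀] at h3
  have h4 : (1 : V.ValueGroup) < (V.valuation (algebraMap k K c))⁻¹ :=
    (one_lt_inv₀ (zero_lt_iff.2 ((Valuation.ne_zero_iff _).2 hz0))).2 hz
  exact absurd h3 (not_le.2 h4)

theorem isRationalPlace_of_subalgebra [IsAlgClosed k] [CharZero k] [Algebra.EssFiniteType k S]
    (hSV : ∀ s ∈ S, V.valuation s ≤ 1)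
    (hconst : ∀ s ∈ S, ∃ c : k, V.valuation (s - algebraMap k K c) < 1)
    {z : K} (hzS : z ∈ S) (hz : V.valuation z < 1) (hz0 : z ≠ 0)
    (hfrac : ∀ g, g ≠ 0 → ∃ n : ℤ, ∃ p ∈ S, ∃ q ∈ S, V.valuation p = 1 ∧ V.valuation q = 1 ∧
      g = z ^ n * (p / q)) :
    IsRationalPlace k V := by
  have hk : ∀ c : k, V.valuation (algebraMap k K c) ≤ 1 := fun c => hSV _ (S.algebraMap_mem c)
  have hz0' : 0 < V.valuation z := zero_lt_iff.2 ((Valuation.ne_zero_iff _).2 hz0)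
  have hval : ∀ (n : ℤ) (p q : K), V.valuation p = 1 → V.valuation q = 1 →
      V.valuation (z ^ n * (p / q)) = V.valuation z ^ n := fun n p q hp hq => by
    rw [map_mul, map_div₀, hp, hq, div_one, mul_one, map_zpow₀]
  -- K is the fraction field of S, hence essentially of finite type over k, which the nonvanishing
  -- of Ω requires.
  have hfr : IsFractionRing S K := by
    refine IsFractionRing.of_field S K fun g => ?_
    by_cases hg : g = 0
    · exact ⟨0, 1, by simp [hg]⟩
    obtain ⟨n, p, hp, q, hq, hp1, hq1, rfl⟩ := hfrac g hg
    obtain ⟨m, rfl | rfl⟩ := n.eq_nat_or_neg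
    · exact ⟨⟨z ^ m * p, S.mul_mem (S.pow_mem hzS m) hp⟩, ⟨q, hq⟩, by
        simp [mul_div_assoc]⟩
    · refine ⟨⟨p, hp⟩, ⟨z ^ m * q, S.mul_mem (S.pow_mem hzS m) hq⟩, ?_⟩
      have : q ≠ 0 := by rintro rfl; simp at hq1
      simp only [zpow_neg, zpow_natCast]
      change (z ^ m)⁻¹ * (p / q) = p / (z ^ m * q)
      field_simp
  have : Algebra.EssFiniteType S K := Algebra.EssFiniteType.of_isLocalization K (nonZeroDivisors S)
  have : Algebra.EssFiniteType k K := Algebra.EssFiniteType.comp k S K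
  refine ⟨hk, ?_, ⟨z, hz, hz0, ?_⟩, ?_, nontrivial_kaehlerDifferential hk hz hz0⟩
  · intro g hg
    rcases hg.lt_or_eq with hg | hg
    · exact ⟨0, by simpa using hg⟩
    have hg0 : g ≠ 0 := by rintro rfl; simp at hg
    obtain ⟨n, p, hp, q, hq, hp1, hq1, rfl⟩ := hfrac g hg0
    rw [hval n p q hp1 hq1] at hg
    have : n = 0 := by
      have h1 := (zpow_le_one_iff_right_of_lt_one₀ hz0' hz).1 hg.le
      by_contra h2
      exact ((zpow_lt_one_iff_right_of_lt_one₀ hz0' hz).2 (by lia)).ne hg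
    subst this
    rw [zpow_zero, one_mul]
    exact exists_const_of_subalgebra hSV hconst hp hq hq1
  · intro g hg
    obtain ⟨n, p, hp, q, hq, hp1, hq1, rfl⟩ := hfrac g hg
    exact ⟨n, hval n p q hp1 hq1⟩
  · refine span_D_fg hSV hzS fun g hg hg0 => ?_
    obtain ⟨n, p, hp, q, hq, hp1, hq1, rfl⟩ := hfrac g hg0
    have h1 := (V.valuation_le_one_iff _).2 hg
    rw [hval n p q hp1 hq1, zpow_le_one_iff_right_of_lt_one₀ hz0' hz] at h1
    exact ⟨n.toNat, p, hp, q, hq, hp1, hq1, by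
      rw [← zpow_natCast, Int.toNat_of_nonneg h1]⟩

end RationalPlace

/-! ## Local algebra at a node -/

section NodePair

open IsLocalRing

variable {O : Type*} [CommRing O] [IsLocalRing O]

/-- Generators of the maximal ideal `m` which form a basis of `m / m²`, and whose product lies
in `m³`. -/
structure IsNodePair (x y : O) : Prop where
  span_eq : Ideal.span {x, y} = maximalIdeal O
  mul_mem : x * y ∈ maximalIdeal O ^ 3
  indep : ∀ a b : O, a * x + b * y ∈ maximalIdeal O ^ 2 → a ∈ maximalIdeal O ∧ b ∈ maximalIdeal O

namespace IsNodePair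

variable {x y : O}

theorem symm (h : IsNodePair x y) : IsNodePair y x where
  span_eq := by rw [Set.pair_comm, h.span_eq]
  mul_mem := by rw [mul_comm]; exact h.mul_mem
  indep a b hab := (h.indep b a (by rwa [add_comm])).symm

theorem left_mem (h : IsNodePair x y) : x ∈ maximalIdeal O :=
  h.span_eq ▸ Ideal.subset_span (by simp)

theorem right_mem (h : IsNodePair x y) : y ∈ maximalIdeal O := h.symm.left_mem

theorem add_mem (h : IsNodePair x y) : x + y ∈ maximalIdeal O :=
  Ideal.add_mem _ h.left_mem h.right_mem

theorem exists_eq (h : IsNodePair x y) {a : O} (ha : a ∈ maximalIdeal O) :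
    ∃ α β, a = α * x + β * y := by
  rw [← h.span_eq, Ideal.mem_span_pair] at ha
  obtain ⟨α, β, e⟩ := ha
  exact ⟨α, β, e.symm⟩

variable [IsNoetherianRing O]

/-- The sum of the generators generates a reduction of the maximal ideal. -/
theorem sq_eq (h : IsNodePair x y) :
    maximalIdeal O ^ 2 = Ideal.span {x + y} * maximalIdeal O := by
  apply le_antisymm
  · refine Submodule.le_of_le_smul_of_le_jacobson_bot (I := maximalIdeal O)
      (IsNoetherian.noetherian _) (maximalIdeal_le_jacobson _) ?_
    have hz : ∀ w ∈ maximalIdeal O, (x + y) * w ∈ Ideal.span {x + y} * maximalIdeal O :=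
      fun w hw => Ideal.mul_mem_mul (Ideal.mem_span_singleton_self _) hw
    -- Modulo m·m², which Nakayama ignores, xy is 0, x² is (x + y)x and y² is (x + y)y.
    have hxy : x * y ∈ maximalIdeal O • maximalIdeal O ^ 2 := by
      rw [smul_eq_mul, ← pow_succ']; exact h.mul_mem
    have hxy' : x * y ∈ Ideal.span {x + y} * maximalIdeal O ⊔ maximalIdeal O • maximalIdeal O ^ 2 :=
      Submodule.mem_sup_right hxy
    have hle : Ideal.span {x * x, x * y, y * x, y * y} ≤
        Ideal.span {x + y} * maximalIdeal O ⊔ maximalIdeal O • maximalIdeal O ^ 2 := by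
      rw [Ideal.span_le]
      rintro _ (rfl | rfl | rfl | rfl)
      · have : x * x = (x + y) * x - x * y := by ring
        rw [SetLike.mem_coe, this]
        exact Ideal.sub_mem _ (Submodule.mem_sup_left (hz _ h.left_mem)) hxy'
      · exact hxy'
      · rw [SetLike.mem_coe, mul_comm y x]; exact hxy'
      · have : y * y = (x + y) * y - x * y := by ring
        rw [SetLike.mem_coe, this]
        exact Ideal.sub_mem _ (Submodule.mem_sup_left (hz _ h.right_mem)) hxy'
    rwa [← Ideal.span_pair_mul_span_pair, h.span_eq, ← sq] at hle
  · rw [sq]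
    exact Ideal.mul_mono_left ((Ideal.span_singleton_le_iff_mem _).2 h.add_mem)

/-- Iterating m² = (x + y)m gives m^(n+m+1) = (x + y)^n m^(m+1). This is the only way in which
fractions with denominator x + y are shown to lie in O. -/
theorem exists_of_mem_pow_succ (h : IsNodePair x y) (n m : ℕ) {a : O}
    (ha : a ∈ maximalIdeal O ^ (n + m + 1)) :
    ∃ a' ∈ maximalIdeal O ^ (m + 1), a = (x + y) ^ n * a' := by
  induction n generalizing a with
  | zero => exact ⟨a, by simpa using ha, by simp⟩
  | succ n ih =>
    have e : maximalIdeal O ^ (n + 1 + m + 1) =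
        Ideal.span {x + y} * maximalIdeal O ^ (n + m + 1) := by
      rw [show n + 1 + m + 1 = 2 + (n + m) by ring, pow_add, h.sq_eq, pow_succ']
      ring
    rw [e, Ideal.mem_span_singleton_mul] at ha
    obtain ⟨b, hb, rfl⟩ := ha
    obtain ⟨a', ha', rfl⟩ := ih hb
    exact ⟨a', ha', by ring⟩

/-- Dividing by (x + y)² yields the integral equation e² − e + c = 0 of e = x/(x + y), with two
simple roots 0 and 1 modulo m. -/
theorem exists_mul_eq (h : IsNodePair x y) : ∃ c ∈ maximalIdeal O, x * y = (x + y) ^ 2 * c := by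
  obtain ⟨c, hc, e⟩ := h.exists_of_mem_pow_succ 2 0 h.mul_mem
  exact ⟨c, by simpa using hc, e⟩

end IsNodePair

/-- The trace on `m` of the ideal of one of the two points above the node. -/
def branchIdeal (x : O) : Ideal O := Ideal.span {x} ⊔ maximalIdeal O ^ 2

namespace IsNodePair

variable {x y : O}

theorem branchIdeal_le (h : IsNodePair x y) : branchIdeal x ≤ maximalIdeal O :=
  sup_le ((Ideal.span_singleton_le_iff_mem _).2 h.left_mem) (Ideal.pow_le_self two_ne_zero)

theorem mem_branchIdeal_iff (h : IsNodePair x y) {α β : O} :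
    α * x + β * y ∈ branchIdeal x ↔ β ∈ maximalIdeal O := by
  constructor
  · intro hm
    obtain ⟨u, hu, w, hw, e⟩ := Submodule.mem_sup.1 hm
    obtain ⟨γ, rfl⟩ := Ideal.mem_span_singleton'.1 hu
    refine (h.indep (α - γ) β ?_).2
    have : (α - γ) * x + β * y = w := by linear_combination -e
    rwa [this]
  · intro hβ
    refine Ideal.add_mem _ (Ideal.mul_mem_left _ _
      (Submodule.mem_sup_left (Ideal.mem_span_singleton_self x))) (Submodule.mem_sup_right ?_)
    rw [sq]
    exact Ideal.mul_mem_mul hβ h.right_mem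

theorem one_notMem (h : IsNodePair x y) : (1 : O) ∉ branchIdeal x :=
  fun h1 => (Ideal.ne_top_iff_one _).1 (maximalIdeal.isMaximal O).ne_top (h.branchIdeal_le h1)

variable [IsNoetherianRing O]

/-- The division step at the first point: there y/(x + y) is a unit, so a(y/(x + y)) = (x + y)a'
splits one factor x + y off a. -/
theorem exists_mul_right_eq (h : IsNodePair x y) {a : O} (ha : a ∈ branchIdeal x) :
    ∃ a' ∈ maximalIdeal O, a * y = (x + y) ^ 2 * a' := by
  have h3 : a * y ∈ maximalIdeal O ^ 3 := by
    obtain ⟨u, hu, w, hw, rfl⟩ := Submodule.mem_sup.1 ha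
    obtain ⟨γ, rfl⟩ := Ideal.mem_span_singleton'.1 hu
    rw [add_mul, mul_assoc, pow_succ]
    refine Ideal.add_mem _ (Ideal.mul_mem_left _ _ ?_) (Ideal.mul_mem_mul hw h.right_mem)
    rw [← pow_succ]
    exact h.mul_mem
  obtain ⟨c, hc, e⟩ := h.exists_of_mem_pow_succ 2 0 h3
  exact ⟨c, by simpa using hc, e⟩

theorem exists_mul_eq_of_notMem (h : IsNodePair x y) {a b : O} (ha : a ∉ branchIdeal x)
    (hb : b ∉ branchIdeal x) : ∃ n, ∃ d ∉ branchIdeal x, a * b = (x + y) ^ n * d := by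
  by_cases ham : a ∈ maximalIdeal O
  swap
  · rw [mem_maximalIdeal, mem_nonunits_iff, not_not] at ham
    refine ⟨0, a * b, fun hab => hb ?_, by simp⟩
    exact (Ideal.unit_mul_mem_iff_mem _ ham).1 hab
  by_cases hbm : b ∈ maximalIdeal O
  swap
  · rw [mem_maximalIdeal, mem_nonunits_iff, not_not] at hbm
    refine ⟨0, a * b, fun hab => ha ?_, by simp⟩
    exact (Ideal.mul_unit_mem_iff_mem _ hbm).1 hab
  obtain ⟨α, β, rfl⟩ := h.exists_eq ham
  obtain ⟨α', β', rfl⟩ := h.exists_eq hbm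
  rw [h.mem_branchIdeal_iff] at ha hb
  -- The product equals (x + y)(αα'x + ββ'y) plus this multiple of xy, which lies in m³ = (x + y)m².
  -- The new coefficient ββ' of y is again a unit.
  have h3 : (α * β' + β * α' - α * α' - β * β') * (x * y) ∈ maximalIdeal O ^ (1 + 1 + 1) :=
    Ideal.mul_mem_left _ _ h.mul_mem
  obtain ⟨w, hw, e⟩ := h.exists_of_mem_pow_succ 1 1 h3
  refine ⟨1, α * α' * x + β * β' * y + w, fun hd => ?_, by linear_combination e⟩
  have hd' := (Ideal.add_mem_iff_left (branchIdeal x) (Submodule.mem_sup_right hw)).1 hd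
  rw [h.mem_branchIdeal_iff] at hd'
  rcases (maximalIdeal.isMaximal O).isPrime.mem_or_mem hd' with h1 | h1
  · exact ha h1
  · exact hb h1

/-- The branch ideal behaves like a prime ideal, up to powers of `x + y`. -/
theorem exists_prod_eq (h : IsNodePair x y) {ι : Type*} (s : Finset ι) (a : ι → O)
    (ha : ∀ i ∈ s, a i ∉ branchIdeal x) :
    ∃ n, ∃ d ∉ branchIdeal x, ∏ i ∈ s, a i = (x + y) ^ n * d := by
  refine Finset.prod_induction a (fun b => ∃ n, ∃ d ∉ branchIdeal x, b = (x + y) ^ n * d) ?_ ?_ ?_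
  · rintro _ _ ⟨n, d, hd, rfl⟩ ⟨n', d', hd', rfl⟩
    obtain ⟨m, e, he, hde⟩ := h.exists_mul_eq_of_notMem hd hd'
    refine ⟨n + n' + m, e, he, ?_⟩
    rw [mul_mul_mul_comm, hde]
    ring
  · exact ⟨0, 1, h.one_notMem, by simp⟩
  · exact fun i hi => ⟨0, a i, ha i hi, by simp⟩

end IsNodePair

end NodePair

/-! ### Valuation rings dominating the local ring of a node -/

section CurveGerm

open IsLocalRing

variable {O : Type*} [CommRing O] [IsLocalRing O]

section Dominates

variable {K : Type*} [Field K]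

/-- The valuation ring `V` dominates the local ring `O`. -/
structure Dominates (φ : O →+* K) (V : ValuationSubring K) : Prop where
  le_one : ∀ a, V.valuation (φ a) ≤ 1
  lt_one : ∀ a ∈ maximalIdeal O, V.valuation (φ a) < 1

variable {φ : O →+* K} {V : ValuationSubring K} {x y : O}

theorem Dominates.eq_one (hV : Dominates φ V) {a : O} (ha : a ∉ maximalIdeal O) :
    V.valuation (φ a) = 1 := by
  rw [mem_maximalIdeal, mem_nonunits_iff, not_not] at ha
  obtain ⟨b, hb⟩ := ha.exists_right_inv
  refine le_antisymm (hV.le_one a) ?_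
  have h1 : V.valuation (φ a) * V.valuation (φ b) = 1 := by
    rw [← map_mul, ← map_mul, hb, map_one, map_one]
  rw [← h1]
  exact mul_le_of_le_one_right' (hV.le_one b)

theorem Dominates.mem_maximalIdeal (hV : Dominates φ V) {a : O} (ha : V.valuation (φ a) < 1) :
    a ∈ maximalIdeal O := by
  by_contra h
  exact ha.ne (hV.eq_one h)

/-- Membership of a fraction in either ring reduces to comparing the same two exponents of z. -/
theorem valuationSubring_eq {A : Type*} [CommRing A] {φ : A →+* K}
    (hfrac : ∀ g, ∃ a b, φ b ≠ 0 ∧ g = φ a / φ b) {z : A}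
    {V' : ValuationSubring K} (hV : V.valuation (φ z) < 1) (hV' : V'.valuation (φ z) < 1)
    (hz : φ z ≠ 0) (h : ∀ a, φ a ≠ 0 → ∃ n : ℕ, V.valuation (φ a) = V.valuation (φ z) ^ n ∧
      V'.valuation (φ a) = V'.valuation (φ z) ^ n) : V = V' := by
  ext g
  rw [← V.valuation_le_one_iff, ← V'.valuation_le_one_iff]
  by_cases hg : g = 0
  · simp [hg]
  obtain ⟨a, b, hb, rfl⟩ := hfrac g
  have ha : φ a ≠ 0 := fun ha => hg (by rw [ha, zero_div])
  obtain ⟨n, hn, hn'⟩ := h a ha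
  obtain ⟨m, hm, hm'⟩ := h b hb
  have hpos : ∀ W : ValuationSubring K, 0 < W.valuation (φ z) := fun W =>
    zero_lt_iff.2 ((Valuation.ne_zero_iff _).2 hz)
  rw [map_div₀, map_div₀, hn, hn', hm, hm', div_le_one₀ (pow_pos (hpos V) m),
    div_le_one₀ (pow_pos (hpos V') m), pow_le_pow_iff_right_of_lt_one₀ (hpos V) hV,
    pow_le_pow_iff_right_of_lt_one₀ (hpos V') hV']

/-- `V` lies over the first of the two points above the node. -/
structure IsFirstBranch (φ : O →+* K) (V : ValuationSubring K) (x y : O) : Prop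
    extends Dominates φ V where
  lt : V.valuation (φ x) < V.valuation (φ (x + y))

namespace IsFirstBranch

theorem pos (hV : IsFirstBranch φ V x y) :
    0 < V.valuation (φ (x + y)) := lt_of_le_of_lt zero_le hV.lt

theorem ne_zero (hV : IsFirstBranch φ V x y) :
    φ (x + y) ≠ 0 := (Valuation.ne_zero_iff V.valuation).1 hV.pos.ne'

theorem right_eq (hV : IsFirstBranch φ V x y) :
    V.valuation (φ y) = V.valuation (φ (x + y)) := by
  have : φ y = φ (x + y) - φ x := by rw [map_add]; ring
  rw [this]
  rw [Valuation.map_sub_swap]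
  exact Valuation.map_sub_eq_of_lt_right _ hV.lt

theorem not_swap (hV : IsFirstBranch φ V x y) : ¬ IsFirstBranch φ V y x := fun h => by
  have h1 := h.lt
  rw [add_comm y x, hV.right_eq] at h1
  exact h1.false

/-- Elements of `m` outside the branch ideal have the same valuation as `x + y`. -/
theorem valuation_eq (hV : IsFirstBranch φ V x y) (h : IsNodePair x y) {d : O}
    (hdm : d ∈ maximalIdeal O) (hd : d ∉ branchIdeal x) :
    V.valuation (φ d) = V.valuation (φ (x + y)) := by
  obtain ⟨α, β, rfl⟩ := h.exists_eq hdm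
  rw [h.mem_branchIdeal_iff] at hd
  have h1 : V.valuation (φ (β * y)) = V.valuation (φ (x + y)) := by
    rw [map_mul, map_mul, hV.eq_one hd, one_mul, hV.right_eq]
  rw [map_add, add_comm, Valuation.map_add_eq_of_lt_left, h1]
  rw [h1, map_mul, map_mul]
  exact lt_of_le_of_lt (mul_le_of_le_one_left' (hV.le_one α)) hV.lt

theorem ne_zero_of_notMem (hV : IsFirstBranch φ V x y) (h : IsNodePair x y) {d : O}
    (hd : d ∉ branchIdeal x) : φ d ≠ 0 := by
  rw [← Valuation.ne_zero_iff V.valuation]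
  by_cases hdm : d ∈ maximalIdeal O
  · rw [hV.valuation_eq h hdm hd]; exact hV.pos.ne'
  · rw [hV.eq_one hdm]; exact one_ne_zero

end IsFirstBranch

/-- The local ring has dimension one. -/
theorem IsNodePair.exists_pow_mem [IsNoetherianRing O] (h : IsNodePair x y) (φ : O →+* K) {a : O}
    (ha : φ a ≠ 0) : ∃ n, (x + y) ^ n ∈ Ideal.span {a} ⊔ RingHom.ker φ := by
  change x + y ∈ (Ideal.span {a} ⊔ RingHom.ker φ).radical
  rw [Ideal.radical_eq_sInf, Submodule.mem_sInf]
  rintro q ⟨hle, hq⟩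
  by_contra hz
  -- As m² = (x + y)m, m is minimal over a principal ideal and has height at most 1 by Krull. A
  -- prime q containing a and the kernel but not x + y would give a chain ker φ < q < m.
  have hm : maximalIdeal O ∈ (Ideal.span {x + y}).minimalPrimes := by
    refine ⟨⟨(maximalIdeal.isMaximal O).isPrime,
      (Ideal.span_singleton_le_iff_mem _).2 h.add_mem⟩, fun p hp _ => ?_⟩
    have := hp.1
    rw [← hp.1.pow_le_iff two_ne_zero, h.sq_eq]
    exact Ideal.mul_le_left.trans hp.2
  have h1 := Ideal.height_le_one_of_isPrincipal_of_mem_minimalPrimes _ _ hm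
  have hp : (RingHom.ker φ).IsPrime := RingHom.ker_isPrime _
  have hlt : RingHom.ker φ < q := lt_of_le_of_ne (le_sup_right.trans hle) fun e =>
    ha (e ▸ hle (Submodule.mem_sup_left (Ideal.mem_span_singleton_self a)) : a ∈ RingHom.ker φ)
  have hlt' : q < maximalIdeal O := lt_of_le_of_ne (le_maximalIdeal hq.ne_top) fun e =>
    hz (e ▸ h.add_mem)
  have h2 := Ideal.height_add_one_le_of_lt_of_isPrime hlt
  have h3 := Ideal.height_add_one_le_of_lt_of_isPrime hlt'
  have h4 : (1 : ℕ∞) + 1 ≤ 1 := by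
    calc (1 : ℕ∞) + 1 ≤ (RingHom.ker φ).height + 1 + 1 := by gcongr; exact le_add_self
      _ ≤ Ideal.height q + 1 := by gcongr
      _ ≤ _ := h3
      _ ≤ 1 := h1
  exact absurd h4 (by decide)

variable [IsNoetherianRing O]

/-- The product xy = (x + y)²c has value below that of (x + y)², so both factors cannot have value
at least that of x + y. Hence there are no places beyond those over the two points. -/
theorem Dominates.lt_or_lt (hV : Dominates φ V) (h : IsNodePair x y) (hz : φ (x + y) ≠ 0) :
    V.valuation (φ x) < V.valuation (φ (x + y)) ∨
      V.valuation (φ y) < V.valuation (φ (x + y)) := by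
  obtain ⟨c, hc, e⟩ := h.exists_mul_eq
  by_contra! hle
  have h0 : 0 < V.valuation (φ (x + y)) := zero_lt_iff.2 ((Valuation.ne_zero_iff _).2 hz)
  have h1 : V.valuation (φ x) * V.valuation (φ y) =
      V.valuation (φ (x + y)) ^ 2 * V.valuation (φ c) := by
    rw [← map_mul, ← map_mul, e, map_mul, map_mul, map_pow, map_pow]
  have h2 : V.valuation (φ (x + y)) ^ 2 ≤ V.valuation (φ x) * V.valuation (φ y) := by
    rw [sq]; exact mul_le_mul' hle.1 hle.2
  rw [h1] at h2
  have h3 := mul_lt_mul_of_pos_left (hV.lt_one c hc) (pow_pos h0 2)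
  rw [mul_one] at h3
  exact absurd h2 (not_le.2 h3)

namespace IsFirstBranch

/-- Every function which does not vanish on the component is, up to a power of `y / (x + y)`, a
power of `x + y` times a function outside the branch ideal. -/
theorem exists_mul_pow_eq (hV : IsFirstBranch φ V x y) (h : IsNodePair x y)
    {a : O} (ha : φ a ≠ 0) :
    ∃ n, ∃ d ∉ branchIdeal x, a * y ^ n = (x + y) ^ (2 * n) * d := by
  by_contra! hcon
  -- If the remainder never left the branch ideal, factors x + y could be split off forever.
  have key : ∀ n, ∃ d, a * y ^ n = (x + y) ^ (2 * n) * d := by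
    intro n
    induction n with
    | zero => exact ⟨a, by simp⟩
    | succ n ih =>
      obtain ⟨d, hd⟩ := ih
      have hdJ : d ∈ branchIdeal x := by
        by_contra hdJ
        exact hcon n d hdJ hd
      obtain ⟨d', -, e⟩ := h.exists_mul_right_eq hdJ
      exact ⟨d', by rw [pow_succ, ← mul_assoc, hd, mul_assoc, e]; ring⟩
  -- V is not yet known to be discrete, so termination comes from dimension one: a divides (x + y)^n
  -- modulo ker φ, which bounds the value of a below by that of (x + y)^n, while n divisions with
  -- remainder in m put it strictly below.
  obtain ⟨n, hn⟩ := h.exists_pow_mem φ ha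
  obtain ⟨d, hd⟩ := key n
  have hdm : d ∈ maximalIdeal O := by
    by_contra hdm
    exact hcon n d (fun hJ => hdm (h.branchIdeal_le hJ)) hd
  have h1 : V.valuation (φ (x + y)) ^ n ≤ V.valuation (φ a) := by
    obtain ⟨u, hu, w, hw, e⟩ := Submodule.mem_sup.1 hn
    obtain ⟨γ, rfl⟩ := Ideal.mem_span_singleton'.1 hu
    have : φ (x + y) ^ n = φ γ * φ a := by
      rw [← map_pow, ← e, map_add, RingHom.mem_ker.1 hw, add_zero, map_mul]
    rw [← map_pow, this, map_mul]
    exact mul_le_of_le_one_left' (hV.le_one γ)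
  have h2 : V.valuation (φ a) * V.valuation (φ (x + y)) ^ n =
      V.valuation (φ (x + y)) ^ n * V.valuation (φ d) * V.valuation (φ (x + y)) ^ n := by
    have := congrArg (fun b => V.valuation (φ b)) hd
    simp only [map_mul, map_pow] at this
    rw [hV.right_eq] at this
    rw [this, two_mul, pow_add]
    exact mul_right_comm _ _ _
  have h3 := mul_right_cancel₀ (pow_pos hV.pos n).ne' h2
  have h4 := mul_lt_mul_of_pos_left (hV.lt_one d hdm) (pow_pos hV.pos n)
  rw [mul_one, ← h3] at h4
  exact absurd h1 (not_le.2 h4)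

/-- If a dies under φ' but not under φ, applying φ' to a y^n = (x + y)^(2n) d gives 0 on the left
and a nonzero element on the right. So the first point lies on a single component. -/
theorem ker_le (hV : IsFirstBranch φ V x y) (h : IsNodePair x y)
    {K' : Type*} [Field K'] {φ' : O →+* K'} {V' : ValuationSubring K'}
    (hV' : IsFirstBranch φ' V' x y) : RingHom.ker φ' ≤ RingHom.ker φ := by
  intro a ha
  by_contra ha'
  obtain ⟨n, d, hd, e⟩ := hV.exists_mul_pow_eq h ha'
  have h1 := congrArg φ' e
  rw [map_mul, map_mul, RingHom.mem_ker.1 ha, zero_mul, map_pow] at h1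
  exact mul_ne_zero (pow_ne_zero _ hV'.ne_zero) (hV'.ne_zero_of_notMem h hd) h1.symm

theorem exists_valuation_eq_pow (hV : IsFirstBranch φ V x y) (h : IsNodePair x y)
    {a : O} (ha : φ a ≠ 0) :
    ∃ n : ℕ, ∀ V' : ValuationSubring K, IsFirstBranch φ V' x y →
      V'.valuation (φ a) = V'.valuation (φ (x + y)) ^ n := by
  obtain ⟨n, d, hd, e⟩ := hV.exists_mul_pow_eq h ha
  have key : ∀ V' : ValuationSubring K, IsFirstBranch φ V' x y →
      V'.valuation (φ a) = V'.valuation (φ (x + y)) ^ n * V'.valuation (φ d) := by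
    intro V' hV'
    have h1 := congrArg (fun b => V'.valuation (φ b)) e
    simp only [map_mul, map_pow] at h1
    rw [hV'.right_eq, two_mul, pow_add, mul_assoc, mul_comm _ (V'.valuation (φ d)),
      ← mul_assoc] at h1
    exact mul_right_cancel₀ (pow_pos hV'.pos n).ne' h1
  by_cases hdm : d ∈ maximalIdeal O
  · exact ⟨n + 1, fun V' hV' => by rw [key V' hV', hV'.valuation_eq h hdm hd, pow_succ]⟩
  · exact ⟨n, fun V' hV' => by rw [key V' hV', hV'.eq_one hdm, mul_one]⟩

theorem eq (hV : IsFirstBranch φ V x y) (h : IsNodePair x y)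
    (hfrac : ∀ g, ∃ a b, φ b ≠ 0 ∧ g = φ a / φ b)
    {V' : ValuationSubring K} (hV' : IsFirstBranch φ V' x y) : V = V' := by
  refine valuationSubring_eq hfrac (hV.lt_one _ h.add_mem) (hV'.lt_one _ h.add_mem) hV.ne_zero
    fun a ha => ?_
  obtain ⟨n, hn⟩ := hV.exists_valuation_eq_pow h ha
  exact ⟨n, hn V hV, hn V' hV'⟩

theorem isUniformizer (hV : IsFirstBranch φ V x y) (h : IsNodePair x y)
    (hfrac : ∀ g, ∃ a b, φ b ≠ 0 ∧ g = φ a / φ b) : IsUniformizer V (φ (x + y)) where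
  lt_one := hV.lt_one _ h.add_mem
  ne_zero := hV.ne_zero
  exists_zpow g hg := by
    obtain ⟨a, b, hb, rfl⟩ := hfrac g
    have ha : φ a ≠ 0 := fun ha => hg (by rw [ha, zero_div])
    obtain ⟨n, hn⟩ := hV.exists_valuation_eq_pow h ha
    obtain ⟨m, hm⟩ := hV.exists_valuation_eq_pow h hb
    refine ⟨(n : ℤ) - m, ?_⟩
    rw [map_div₀, hn V hV, hm V hV, zpow_sub₀ hV.pos.ne', zpow_natCast, zpow_natCast]

/-- There is a place over the first point above the node on each component through it. -/
theorem exists_of_ker_le {φ : O →+* K} (h : IsNodePair x y) (hz : φ (x + y) ≠ 0)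
    (hker : RingHom.ker φ ≤ branchIdeal x) : ∃ V, IsFirstBranch φ V x y := by
  obtain ⟨c, hc, e⟩ := h.exists_mul_eq
  set w : K := φ x / φ (x + y) with hw
  have hwz : w * φ (x + y) = φ x := div_mul_cancel₀ _ hz
  have hw2 : w * w = w - φ c := by
    apply mul_right_cancel₀ (pow_ne_zero 2 hz)
    have h1 : φ x * φ y = φ (x + y) ^ 2 * φ c := by
      rw [← map_mul, e, map_mul, map_pow]
    rw [map_add] at h1 hwz ⊢
    linear_combination (w * (φ x + φ y) + φ x - (φ x + φ y)) * hwz - h1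
  -- A is φ(O)[w], spanned over φ(O) by 1 and w because w² = w − φ(c); below, I is the ideal
  -- generated by m and w, that is, the first point.
  let A : Subring K :=
    { carrier := {g | ∃ α β, g = φ α + φ β * w}
      zero_mem' := ⟨0, 0, by simp⟩
      one_mem' := ⟨1, 0, by simp⟩
      add_mem' := by
        rintro _ _ ⟨α, β, rfl⟩ ⟨α', β', rfl⟩
        exact ⟨α + α', β + β', by simp only [map_add]; ring⟩
      neg_mem' := by
        rintro _ ⟨α, β, rfl⟩
        exact ⟨-α, -β, by simp only [map_neg]; ring⟩
      mul_mem' := by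
        rintro _ _ ⟨α, β, rfl⟩ ⟨α', β', rfl⟩
        refine ⟨α * α' - β * β' * c, α * β' + β * α' + β * β', ?_⟩
        simp only [map_add, map_sub, map_mul]
        linear_combination φ β * φ β' * hw2 }
  let I : Ideal A :=
    { carrier := {g | ∃ α ∈ maximalIdeal O, ∃ β, (g : K) = φ α + φ β * w}
      zero_mem' := ⟨0, zero_mem _, 0, by simp⟩
      add_mem' := by
        rintro g g' ⟨α, hα, β, hg⟩ ⟨α', hα', β', hg'⟩
        exact ⟨α + α', Ideal.add_mem _ hα hα', β + β', by
          simp only [map_add, Subring.coe_add, hg, hg']; ring⟩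
      smul_mem' := by
        rintro ⟨_, α', β', rfl⟩ g ⟨α, hα, β, hg⟩
        refine ⟨α' * α - β' * β * c, Ideal.sub_mem _ (Ideal.mul_mem_left _ _ hα)
          (Ideal.mul_mem_left _ _ hc), α' * β + β' * α + β' * β, ?_⟩
        simp only [smul_eq_mul, Subring.coe_mul, hg, map_add, map_sub, map_mul]
        linear_combination φ β * φ β' * hw2 }
  -- Clearing x + y from 1 = φ(α) + φ(β)w puts (1 − α − β)x + (1 − α)y into ker φ, hence into the
  -- branch ideal, forcing 1 − α ∈ m although α ∈ m.
  have hI : I ≠ ⊤ := by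
    rw [Ideal.ne_top_iff_one]
    rintro ⟨α, hα, β, h1⟩
    have h2 : (1 - α) * (x + y) - β * x ∈ RingHom.ker φ := by
      rw [RingHom.mem_ker]
      have h3 : (1 : K) = φ α + φ β * w := h1
      simp only [map_sub, map_mul, map_one]
      linear_combination φ (x + y) * h3 + φ β * hwz
    have h4 : (1 - α - β) * x + (1 - α) * y ∈ branchIdeal x := by
      have := hker h2
      have e : (1 - α - β) * x + (1 - α) * y = (1 - α) * (x + y) - β * x := by ring
      rwa [e]
    rw [h.mem_branchIdeal_iff] at h4
    have h5 := Ideal.add_mem _ h4 hα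
    rw [sub_add_cancel] at h5
    exact (Ideal.ne_top_iff_one _).1 (maximalIdeal.isMaximal O).ne_top h5
  obtain ⟨V, hAV, hIV⟩ := I.image_subset_nonunits_valuationSubring hI
  have hO : ∀ a, φ a ∈ A := fun a => ⟨a, 0, by simp⟩
  refine ⟨V, ⟨⟨fun a => (V.valuation_le_one_iff _).2 (hAV (hO a)), fun a ha => ?_⟩, ?_⟩⟩
  · exact V.mem_nonunits_iff.1 (hIV ⟨⟨φ a, hO a⟩, ⟨a, ha, 0, by simp⟩, rfl⟩)
  · have h1 : V.valuation w < 1 := V.mem_nonunits_iff.1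
      (hIV ⟨⟨w, 0, 1, by simp⟩, ⟨0, zero_mem _, 1, by simp⟩, rfl⟩)
    rw [← hwz, map_mul]
    have h2 := mul_lt_mul_of_pos_right h1
      (zero_lt_iff.2 ((Valuation.ne_zero_iff V.valuation).2 hz))
    rwa [one_mul] at h2

end IsFirstBranch

end Dominates

end CurveGerm

/-! ### All components through the point together -/

section CurveGerm

open IsLocalRing

variable {O : Type*} [CommRing O] {ι : Type*} {K : ι → Type*} [∀ i, Field (K i)]

/-- The maps from the local ring of a curve at a point to the function fields of the irreducible
components through the point. -/
structure IsCurveGerm (φ : ∀ i, O →+* K i) : Prop where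
  frac : ∀ i (g : K i), ∃ a b, φ i b ≠ 0 ∧ g = φ i a / φ i b
  eq_of_ker_le : ∀ i j, RingHom.ker (φ i) ≤ RingHom.ker (φ j) → i = j
  exists_ker_le : ∀ p : Ideal O, p.IsPrime → ∃ i, RingHom.ker (φ i) ≤ p

namespace IsCurveGerm

variable {φ : ∀ i, O →+* K i} {x y : O}

theorem ker_mem_minimalPrimes (hφ : IsCurveGerm φ) (i : ι) :
    RingHom.ker (φ i) ∈ minimalPrimes O := by
  refine ⟨⟨RingHom.ker_isPrime _, bot_le⟩, fun q hq hle => ?_⟩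
  obtain ⟨j, hj⟩ := hφ.exists_ker_le q hq.1
  rwa [← hφ.eq_of_ker_le j i (hj.trans hle)]

theorem finite [IsNoetherianRing O] (hφ : IsCurveGerm φ) : Finite ι :=
  have := (minimalPrimes.finite_of_isNoetherianRing O).to_subtype
  Finite.of_injective (fun i => (⟨_, hφ.ker_mem_minimalPrimes i⟩ : minimalPrimes O))
    fun i j hij => hφ.eq_of_ker_le i j (congrArg Subtype.val hij).le

theorem eq_zero [IsReduced O] (hφ : IsCurveGerm φ) {a : O} (ha : ∀ i, φ i a = 0) : a = 0 := by
  have h : a ∈ nilradical O := by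
    rw [nilradical_eq_sInf, Submodule.mem_sInf]
    intro p hp
    obtain ⟨i, hi⟩ := hφ.exists_ker_le p hp
    exact hi (ha i)
  rwa [nilradical_eq_zero] at h

/-- For every component there is a function which vanishes exactly on the other components. -/
theorem exists_separating [Finite ι] (hφ : IsCurveGerm φ) (i : ι) :
    ∃ w, φ i w ≠ 0 ∧ ∀ j, j ≠ i → φ j w = 0 := by
  classical
  have := Fintype.ofFinite ι
  have h : ∀ j, j ≠ i → ∃ a, φ i a ≠ 0 ∧ φ j a = 0 := fun j hj => by
    by_contra! hcon
    exact hj (hφ.eq_of_ker_le j i fun a ha => by_contra fun h => hcon a h ha)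
  choose! a ha ha' using h
  refine ⟨∏ j ∈ Finset.univ.erase i, a j, ?_, fun j hj => ?_⟩
  · rw [map_prod, Finset.prod_ne_zero_iff]
    exact fun j hj => ha j (Finset.ne_of_mem_erase hj)
  · rw [map_prod]
    exact Finset.prod_eq_zero (Finset.mem_erase.2 ⟨hj, Finset.mem_univ j⟩) (ha' j hj)

variable [IsLocalRing O] [IsNoetherianRing O]

/-- If x + y vanished on a component, m² = (x + y)m would place m in the corresponding minimal
prime. There would then be one component, with kernel m, and reducedness would give x = 0, against
the independence of x, y. -/
theorem add_ne_zero [IsReduced O] (hφ : IsCurveGerm φ) (h : IsNodePair x y) (i : ι) :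
    φ i (x + y) ≠ 0 := by
  intro h0
  have h1 : maximalIdeal O ≤ RingHom.ker (φ i) := by
    have hp : (RingHom.ker (φ i)).IsPrime := RingHom.ker_isPrime _
    rw [← hp.pow_le_iff two_ne_zero, h.sq_eq]
    exact Ideal.mul_le_left.trans ((Ideal.span_singleton_le_iff_mem _).2 h0)
  have h2 : x = 0 := hφ.eq_zero fun j => by
    rw [hφ.eq_of_ker_le j i ((le_maximalIdeal (RingHom.ker_ne_top _)).trans h1)]
    exact h1 h.left_mem
  refine (Ideal.ne_top_iff_one _).1 (maximalIdeal.isMaximal O).ne_top (h.indep 1 0 ?_).1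
  simp [h2]

theorem add_mul_cancel [IsReduced O] (hφ : IsCurveGerm φ) (h : IsNodePair x y) {n : ℕ} {a b : O}
    (e : (x + y) ^ n * a = (x + y) ^ n * b) : a = b := by
  rw [← sub_eq_zero]
  refine hφ.eq_zero fun i => ?_
  have h1 := congrArg (φ i) e
  rw [map_mul, map_mul, map_pow] at h1
  rw [map_sub, mul_left_cancel₀ (pow_ne_zero n (hφ.add_ne_zero h i)) h1, sub_self]

/-- A power of `x + y` is a common denominator of any family of rational functions. -/
theorem exists_denominator (hφ : IsCurveGerm φ) (h : IsNodePair x y) (q : ∀ i, K i) :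
    ∃ n a, ∀ i, φ i a = φ i (x + y) ^ n * q i := by
  classical
  have := hφ.finite
  have := Fintype.ofFinite ι
  -- Treat one component at a time: the separating function w kills the others, and bw divides a
  -- power of x + y modulo the kernel.
  have key : ∀ i, ∃ n a, φ i a = φ i (x + y) ^ n * q i ∧ ∀ j, j ≠ i → φ j a = 0 := by
    intro i
    obtain ⟨a, b, hb, hq⟩ := hφ.frac i (q i)
    obtain ⟨w, hw, hw'⟩ := hφ.exists_separating i
    obtain ⟨n, hn⟩ := h.exists_pow_mem (φ i) (a := b * w) (by
      rw [map_mul]; exact mul_ne_zero hb hw)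
    obtain ⟨u, hu, s, hs, e⟩ := Submodule.mem_sup.1 hn
    obtain ⟨c, rfl⟩ := Ideal.mem_span_singleton'.1 hu
    refine ⟨n, a * (c * w), ?_, fun j hj => by rw [map_mul, map_mul, hw' j hj]; ring⟩
    have h1 := congrArg (φ i) e
    rw [map_add, RingHom.mem_ker.1 hs, add_zero, map_pow] at h1
    rw [← h1, hq]
    simp only [map_mul]
    field_simp
  choose n a ha ha' using key
  refine ⟨∑ i, n i, ∑ i, (x + y) ^ (∑ j ∈ Finset.univ.erase i, n j) * a i, fun i => ?_⟩
  rw [map_sum, Finset.sum_eq_single i]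
  · rw [map_mul, ha, map_pow, ← mul_assoc, ← pow_add,
      Finset.sum_erase_add _ _ (Finset.mem_univ i)]
  · intro j _ hj
    rw [map_mul, ha' j i (Ne.symm hj), mul_zero]
  · exact fun hi => absurd (Finset.mem_univ i) hi

/-- Over the first point above the node there is a place. -/
theorem exists_isFirstBranch [IsReduced O] (hφ : IsCurveGerm φ) (h : IsNodePair x y) :
    ∃ i V, IsFirstBranch (φ i) V x y := by
  have := hφ.finite
  have := Fintype.ofFinite ι
  -- Otherwise pick in each kernel an element outside the branch ideal. Their product is zero, yet
  -- equals (x + y)^n d with d outside the branch ideal; cancelling the power of x + y gives d = 0.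
  obtain ⟨i, hi⟩ : ∃ i, RingHom.ker (φ i) ≤ branchIdeal x := by
    by_contra! hcon
    have h1 : ∀ i, ∃ a, φ i a = 0 ∧ a ∉ branchIdeal x := fun i => by
      obtain ⟨a, ha, ha'⟩ := Set.not_subset.1 (hcon i)
      exact ⟨a, ha, ha'⟩
    choose a ha ha' using h1
    obtain ⟨n, d, hd, e⟩ := h.exists_prod_eq Finset.univ a fun i _ => ha' i
    have h2 : d = 0 := hφ.add_mul_cancel h (n := n) (by
      rw [← e, mul_zero]
      refine hφ.eq_zero fun i => ?_
      rw [map_prod]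
      exact Finset.prod_eq_zero (Finset.mem_univ i) (ha i))
    exact hd (h2 ▸ zero_mem _)
  exact ⟨i, IsFirstBranch.exists_of_ker_le h (hφ.add_ne_zero h i) hi⟩

/-- Over the first point above the node there is at most one place. -/
theorem isFirstBranch_index_eq (hφ : IsCurveGerm φ) (h : IsNodePair x y) {i j : ι}
    {V : ValuationSubring (K i)} {V' : ValuationSubring (K j)} (hV : IsFirstBranch (φ i) V x y)
    (hV' : IsFirstBranch (φ j) V' x y) : i = j :=
  (hφ.eq_of_ker_le j i (hV.ker_le h hV')).symm

theorem isFirstBranch_eq (hφ : IsCurveGerm φ) (h : IsNodePair x y) {i : ι}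
    {V V' : ValuationSubring (K i)} (hV : IsFirstBranch (φ i) V x y)
    (hV' : IsFirstBranch (φ i) V' x y) : V = V' :=
  hV.eq h (hφ.frac i) hV'

/-- The product of an element of the maximal ideal and a rational function which is regular at both
points above the node is regular. -/
theorem exists_mul_eq_of_integral [IsReduced O] (hφ : IsCurveGerm φ) (h : IsNodePair x y)
    {q : ∀ i, K i} {i j : ι} {V : ValuationSubring (K i)} {V' : ValuationSubring (K j)}
    (hV : IsFirstBranch (φ i) V x y) (hV' : IsFirstBranch (φ j) V' y x)
    (hq : V.valuation (q i) ≤ 1) (hq' : V'.valuation (q j) ≤ 1) :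
    ∃ a ∈ maximalIdeal O, ∀ l, φ l a = φ l (x + y) * q l := by
  obtain ⟨n, a, ha⟩ := hφ.exists_denominator h q
  induction n generalizing a with
  | zero =>
    exact ⟨(x + y) * a, Ideal.mul_mem_right _ _ h.add_mem, fun l => by
      rw [map_mul, ha]; simp⟩
  | succ n ih =>
    have hlt := hV.lt_one _ h.add_mem
    have hlt' := hV'.lt_one _ h.add_mem
    have ham : a ∈ maximalIdeal O := by
      refine hV.toDominates.mem_maximalIdeal ?_
      rw [ha, map_mul, map_pow]
      exact lt_of_le_of_lt (mul_le_of_le_one_right' hq) (pow_lt_one₀ zero_le hlt (by lia))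
    by_cases hn : n = 0
    · exact ⟨a, ham, fun l => by rw [ha, hn, zero_add, pow_one]⟩
    obtain ⟨α, β, rfl⟩ := h.exists_eq ham
    -- With denominator exponent n + 1 ≥ 2, the numerator vanishes to order at least 2 at both
    -- points. So both coefficients lie in m, the numerator is in m² = (x + y)m, and the exponent
    -- drops; it stops at 1.
    have key : ∀ {x y : O} {i : ι} {V : ValuationSubring (K i)} (h : IsNodePair x y)
        (hV : IsFirstBranch (φ i) V x y) (α β : O) (_ : V.valuation (q i) ≤ 1)
        (_ : φ i (α * x + β * y) = φ i (x + y) ^ (n + 1) * q i), β ∈ maximalIdeal O := by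
      intro x y i V h hV α β hq ha
      by_contra hβ
      have h1 := hV.valuation_eq h (d := α * x + β * y)
        (Ideal.add_mem _ (Ideal.mul_mem_left _ _ h.left_mem) (Ideal.mul_mem_left _ _ h.right_mem))
        (fun hm => hβ (h.mem_branchIdeal_iff.1 hm))
      rw [ha, map_mul, map_pow, pow_succ'] at h1
      have h2 : V.valuation (φ i (x + y)) * V.valuation (φ i (x + y)) ^ n * V.valuation (q i) <
          V.valuation (φ i (x + y)) := by
        refine lt_of_le_of_lt (mul_le_of_le_one_right' hq) ?_
        calc _ < V.valuation (φ i (x + y)) * 1 :=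
              mul_lt_mul_of_pos_left (pow_lt_one₀ zero_le (hV.lt_one _ h.add_mem) hn) hV.pos
          _ = _ := mul_one _
      exact h2.ne h1
    have hβ := key h hV α β hq (ha i)
    have hα := key h.symm hV' β α hq' (by rw [add_comm, add_comm y x]; exact ha j)
    have h2 : α * x + β * y ∈ maximalIdeal O ^ (1 + 0 + 1) := by
      rw [add_zero, pow_add, pow_one]
      exact Ideal.add_mem _ (Ideal.mul_mem_mul hα h.left_mem) (Ideal.mul_mem_mul hβ h.right_mem)
    obtain ⟨a', -, e⟩ := h.exists_of_mem_pow_succ 1 0 h2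
    refine ih a' fun l => ?_
    have h3 := ha l
    rw [e, map_mul, map_pow, pow_one, pow_succ', mul_assoc] at h3
    exact mul_left_cancel₀ (hφ.add_ne_zero h l) h3

end IsCurveGerm

end CurveGerm

/-! ### Rationality of the dominating places -/

section Dominates

open IsLocalRing Polynomial

variable {k O K : Type u} [Field k] [CommRing O] [IsLocalRing O] [Algebra k O] [Field K]
  [Algebra k K] {V : ValuationSubring K}

/-- A place whose ring is obtained from `O[e]`, for a local ring `O` of a curve, by inverting
units. -/
theorem Dominates.isRationalPlace [IsAlgClosed k] [CharZero k] [Algebra.EssFiniteType k O]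
    {φ : O →+* K} (hφ : ∀ c : k, φ (algebraMap k O c) = algebraMap k K c) (hV : Dominates φ V)
    (hO : ∀ a : O, ∃ c : k, a - algebraMap k O c ∈ maximalIdeal O)
    (hK : ∀ g, ∃ a b, φ b ≠ 0 ∧ g = φ a / φ b) {z : O} (hzm : z ∈ maximalIdeal O) (hz : φ z ≠ 0)
    {e : K} (he : V.valuation e < 1)
    (hfrac : ∀ a, φ a ≠ 0 → ∃ n, ∃ P Q : O[X], V.valuation (P.eval₂ φ e) = 1 ∧
      V.valuation (Q.eval₂ φ e) = 1 ∧ φ a * Q.eval₂ φ e = φ z ^ n * P.eval₂ φ e) :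
    IsRationalPlace k V := by
  let φ' : O →ₐ[k] K := { φ with commutes' := hφ }
  let F : O[X] →ₐ[k] K := eval₂AlgHom φ' e fun _ => Commute.all _ _
  have hF : ∀ P, F P = P.eval₂ φ e := fun P => rfl
  have hess : Algebra.EssFiniteType k O[X] := Algebra.EssFiniteType.comp k O O[X]
  have hess' : Algebra.EssFiniteType k F.range :=
    Algebra.EssFiniteType.of_surjective F.rangeRestrict F.rangeRestrict_surjective
  have hle : ∀ P : O[X], V.valuation (P.eval₂ φ e) ≤ 1 := by
    intro P
    rw [eval₂_eq_sum, Polynomial.sum]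
    refine Valuation.map_sum_le _ fun n _ => ?_
    rw [map_mul, map_pow]
    exact mul_le_one' (hV.le_one _) (pow_le_one₀ zero_le he.le)
  have hCF : ∀ a, φ a = F (C a) := fun a => by rw [hF, eval₂_C]
  refine isRationalPlace_of_subalgebra (S := F.range) (z := φ z) ?_ ?_ ⟨C z, (hCF z).symm⟩
    (hV.lt_one z hzm) hz ?_
  · rintro _ ⟨P, rfl⟩
    exact hle P
  · rintro _ ⟨P, rfl⟩
    obtain ⟨c, hc⟩ := hO (P.coeff 0)
    refine ⟨c, ?_⟩
    -- As e lies in the maximal ideal of V, P(e) is congruent to the constant coefficient of P,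
    -- which O reduces to an element of k.
    have h1 : F P - algebraMap k K c =
        P.divX.eval₂ φ e * e + φ (P.coeff 0 - algebraMap k O c) := by
      conv_lhs => rw [hF, ← P.divX_mul_X_add, eval₂_add, eval₂_mul_X, eval₂_C]
      rw [map_sub, hφ]
      ring
    change V.valuation (F P - algebraMap k K c) < 1
    rw [h1]
    refine Valuation.map_add_lt _ ?_ (hV.lt_one _ hc)
    rw [map_mul]
    exact lt_of_le_of_lt (mul_le_of_le_one_left' (hle _)) he
  · intro g hg
    obtain ⟨a, b, hb, rfl⟩ := hK g
    have ha : φ a ≠ 0 := fun ha => hg (by rw [ha, zero_div])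
    obtain ⟨n, P, Q, hP, hQ, e1⟩ := hfrac a ha
    obtain ⟨m, P', Q', hP', hQ', e2⟩ := hfrac b hb
    refine ⟨(n : ℤ) - m, F (P * Q'), ⟨_, rfl⟩, F (Q * P'), ⟨_, rfl⟩, ?_, ?_, ?_⟩
    · rw [map_mul, map_mul, hF, hF, hP, hQ', one_mul]
    · rw [map_mul, map_mul, hF, hF, hQ, hP', one_mul]
    · have h0 : ∀ {P : O[X]}, V.valuation (P.eval₂ φ e) = 1 → P.eval₂ φ e ≠ 0 :=
        fun {P} h h0 => by rw [h0, map_zero] at h; exact zero_ne_one h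
      have hP0 := h0 hP
      have hQ0 := h0 hQ
      have hP0' := h0 hP'
      have hQ0' := h0 hQ'
      rw [map_mul, map_mul, hF, hF, hF, hF, zpow_sub₀ hz, zpow_natCast, zpow_natCast]
      rw [eq_div_of_mul_eq hQ0 e1, eq_div_of_mul_eq hQ0' e2]
      field_simp

/-- Take e = x/(x + y), so that 1 − e = y/(x + y) is a unit of V and serves as the denominator Q. -/
theorem IsFirstBranch.isRationalPlace [IsAlgClosed k] [CharZero k] [Algebra.EssFiniteType k O]
    [IsNoetherianRing O] {φ : O →+* K} (hφ : ∀ c : k, φ (algebraMap k O c) = algebraMap k K c)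
    {x y : O} (hV : IsFirstBranch φ V x y) (h : IsNodePair x y)
    (hO : ∀ a : O, ∃ c : k, a - algebraMap k O c ∈ maximalIdeal O)
    (hK : ∀ g, ∃ a b, φ b ≠ 0 ∧ g = φ a / φ b) : IsRationalPlace k V := by
  have hz := hV.ne_zero
  have he : V.valuation (φ x / φ (x + y)) < 1 := by
    rw [map_div₀, div_lt_one₀ hV.pos]
    exact hV.lt
  refine hV.toDominates.isRationalPlace hφ hO hK h.add_mem hz he fun a ha => ?_
  obtain ⟨n, d, hd, e⟩ := hV.exists_mul_pow_eq h ha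
  have hQ : ((1 - X : O[X]) ^ n).eval₂ φ (φ x / φ (x + y)) = (φ y / φ (x + y)) ^ n := by
    rw [eval₂_pow, eval₂_sub, eval₂_one, eval₂_X]
    congr 1
    rw [map_add] at hz ⊢
    field_simp
    ring
  have hQ1 : V.valuation ((φ y / φ (x + y)) ^ n) = 1 := by
    rw [map_pow, map_div₀, hV.right_eq, div_self hV.pos.ne', one_pow]
  have e' : φ a * (φ y / φ (x + y)) ^ n = φ (x + y) ^ n * φ d := by
    have h1 := congrArg φ e
    rw [map_mul, map_mul, map_pow, map_pow] at h1
    rw [div_pow, mul_div_assoc', h1, two_mul, pow_add]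
    field_simp
  by_cases hdm : d ∈ maximalIdeal O
  · obtain ⟨α, β, rfl⟩ := h.exists_eq hdm
    have hP : (C α * X + C β * (1 - X) : O[X]).eval₂ φ (φ x / φ (x + y)) =
        φ (α * x + β * y) / φ (x + y) := by
      simp only [eval₂_add, eval₂_mul, eval₂_sub, eval₂_one, eval₂_X, eval₂_C]
      simp only [map_add, map_mul] at hz ⊢
      field_simp
      ring
    -- A remainder d = αx + βy in m still carries one factor x + y; αe + β(1 − e) is the unit left
    -- after dividing it out.
    refine ⟨n + 1, C α * X + C β * (1 - X), (1 - X) ^ n, ?_, by rw [hQ, hQ1], ?_⟩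
    · rw [hP, map_div₀, hV.valuation_eq h hdm hd, div_self hV.pos.ne']
    · rw [hQ, hP, e']
      field_simp
      ring
  · exact ⟨n, C d, (1 - X) ^ n, by rw [eval₂_C, hV.eq_one hdm], by rw [hQ, hQ1], by
      rw [hQ, eval₂_C, e']⟩

end Dominates

/-! ### From the completion to a pair of generators -/

section Completion

open IsLocalRing

theorem MvPowerSeries.exists_eq_add_X_mul {k : Type*} [Field k] (f : MvPowerSeries (Fin 2) k) :
    ∃ g h, f = MvPowerSeries.C (MvPowerSeries.constantCoeff f) + MvPowerSeries.X 0 * g +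
      MvPowerSeries.X 1 * h := by
  classical
  -- The part of f without constant term free of the first variable, hence divisible by the second.
  let f₁ : MvPowerSeries (Fin 2) k := fun m => if m 0 = 0 then
    MvPowerSeries.coeff m (f - MvPowerSeries.C (MvPowerSeries.constantCoeff f)) else 0
  have hf₁ : ∀ m, MvPowerSeries.coeff m f₁ = if m 0 = 0 then
    MvPowerSeries.coeff m (f - MvPowerSeries.C (MvPowerSeries.constantCoeff f)) else 0 :=
    fun m => rfl
  obtain ⟨h, hh⟩ : (MvPowerSeries.X 1 : MvPowerSeries (Fin 2) k) ∣ f₁ := by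
    rw [MvPowerSeries.X_dvd_iff]
    intro m hm
    rw [hf₁]
    split_ifs with h0
    · have : m = 0 := by
        ext i
        fin_cases i
        · exact h0
        · exact hm
      simp [this]
    · rfl
  obtain ⟨g, hg⟩ : (MvPowerSeries.X 0 : MvPowerSeries (Fin 2) k) ∣
      f - MvPowerSeries.C (MvPowerSeries.constantCoeff f) - f₁ := by
    rw [MvPowerSeries.X_dvd_iff]
    intro m hm
    rw [map_sub, hf₁, if_pos hm, sub_self]
  exact ⟨g, h, by rw [← hg, ← hh]; ring⟩

theorem MvPowerSeries.X_notMem_span {k : Type*} [Field k] {i j : Fin 2} (hij : i ≠ j) :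
    (MvPowerSeries.X i : MvPowerSeries (Fin 2) k) ∉
      Ideal.span {(MvPowerSeries.X i * MvPowerSeries.X j : MvPowerSeries (Fin 2) k)} := by
  intro h
  obtain ⟨g, hg⟩ := Ideal.mem_span_singleton'.1 h
  have h1 : (MvPowerSeries.X j : MvPowerSeries (Fin 2) k) ∣ MvPowerSeries.X i :=
    ⟨g * MvPowerSeries.X i, by linear_combination -hg⟩
  rw [MvPowerSeries.X_dvd_iff] at h1
  have h2 := h1 (Finsupp.single i 1) (Finsupp.single_eq_of_ne hij.symm)
  rw [MvPowerSeries.coeff_index_single_self_X] at h2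
  exact one_ne_zero h2

variable {O : Type*} [CommRing O] [IsLocalRing O]

theorem exists_eq_pow_mul_of_notMem {t : O} (ht : Ideal.span {t} = maximalIdeal O) {n : ℕ} {a : O}
    (ha : a ∉ maximalIdeal O ^ n) : ∃ i < n, ∃ u, IsUnit u ∧ a = t ^ i * u := by
  induction n with
  | zero => simp at ha
  | succ n ih =>
    by_cases hn : a ∈ maximalIdeal O ^ n
    · have hn' := hn
      rw [← ht, Ideal.span_singleton_pow] at hn'
      obtain ⟨u, rfl⟩ := Ideal.mem_span_singleton.1 hn'
      refine ⟨n, n.lt_succ_self, u, by_contra fun hu => ha ?_, rfl⟩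
      rw [pow_succ]
      exact Ideal.mul_mem_mul (Ideal.pow_mem_pow (ht ▸ Ideal.mem_span_singleton_self t) n)
        ((mem_maximalIdeal u).2 hu)
    · obtain ⟨i, hi, u, hu, e⟩ := ih hn
      exact ⟨i, hi.trans n.lt_succ_self, u, hu, e⟩

/-- The completion of a reduced local ring with principal maximal ideal is a domain. -/
theorem eq_zero_or_eq_zero_of_mul [IsReduced O] {t : O} (ht : Ideal.span {t} = maximalIdeal O)
    {A B : AdicCompletion (maximalIdeal O) O} (hAB : A * B = 0) : A = 0 ∨ B = 0 := by
  by_contra! hcon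
  -- A nonzero element has a bounded order: for one n, its image at every level N ≥ n has a
  -- representative outside m^n. This allows both factors to be compared at level n + n'.
  have key : ∀ A : AdicCompletion (maximalIdeal O) O, A ≠ 0 → ∃ n, ∀ N, n ≤ N →
      ∃ a ∉ maximalIdeal O ^ n, AdicCompletion.evalₐ (maximalIdeal O) N A =
        Ideal.Quotient.mk _ a := by
    intro A hA
    by_contra! h
    refine hA (AdicCompletion.ext_evalₐ fun n => ?_)
    obtain ⟨N, hN, h1⟩ := h n
    obtain ⟨a, rfl⟩ := AdicCompletion.mk_surjective _ _ A
    by_contra h2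
    refine h1 (a N) (fun h3 => h2 ?_) (AdicCompletion.evalₐ_mk _ _ _)
    rw [AdicCompletion.evalₐ_mk, map_zero, Ideal.Quotient.eq_zero_iff_mem]
    have h4 := a.2 hN
    rw [SModEq.sub_mem] at h4
    have h5 : a.1 n - a.1 N ∈ maximalIdeal O ^ n := by simpa using h4
    exact (Submodule.sub_mem_iff_left _ h3).1 h5
  obtain ⟨n, hn⟩ := key A hcon.1
  obtain ⟨n', hn'⟩ := key B hcon.2
  obtain ⟨a, ha, hA⟩ := hn (n + n') (Nat.le_add_right _ _)
  obtain ⟨b, hb, hB⟩ := hn' (n + n') (Nat.le_add_left _ _)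
  have hab : a * b ∈ maximalIdeal O ^ (n + n') := by
    rw [← Ideal.Quotient.eq_zero_iff_mem, map_mul, ← hA, ← hB, ← map_mul, hAB, map_zero]
  obtain ⟨i, hi, u, hu, rfl⟩ := exists_eq_pow_mul_of_notMem ht ha
  obtain ⟨j, hj, v, hv, rfl⟩ := exists_eq_pow_mul_of_notMem ht hb
  have htij : t ^ (i + j) ∈ maximalIdeal O ^ (n + n') := by
    rw [← Ideal.mul_unit_mem_iff_mem _ (hu.mul hv)]
    convert hab using 1
    ring
  -- Since i + j < n + n', membership in (t^(n+n')) reads t^(i+j)(1 − t^l w) = 0 with l > 0, and the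
  -- second factor is a unit.
  have ht0 : t ^ (i + j) = 0 := by
    rw [← ht, Ideal.span_singleton_pow] at htij
    obtain ⟨w, hw⟩ := Ideal.mem_span_singleton.1 htij
    obtain ⟨l, hl, hl'⟩ : ∃ l, l ≠ 0 ∧ n + n' = i + j + l := ⟨n + n' - (i + j), by lia, by lia⟩
    have h1 : t ^ (i + j) * (1 - t ^ l * w) = 0 := by
      rw [mul_sub, mul_one, ← mul_assoc, ← pow_add, ← hl', ← hw, sub_self]
    have h2 : IsUnit (1 - t ^ l * w) := by
      by_contra h2
      have h3 : t ^ l * w ∈ maximalIdeal O := Ideal.mul_mem_right _ _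
        (Ideal.pow_mem_of_mem _ (ht ▸ Ideal.mem_span_singleton_self t) _ (Nat.pos_of_ne_zero hl))
      have h4 := Ideal.add_mem _ ((mem_maximalIdeal _).2 h2) h3
      rw [sub_add_cancel] at h4
      exact (Ideal.ne_top_iff_one _).1 (maximalIdeal.isMaximal O).ne_top h4
    exact h2.mul_left_eq_zero.1 h1
  have ht00 : t = 0 := eq_zero_of_pow_eq_zero ht0
  subst ht00
  have hi0 : i = 0 := by
    by_contra hi0
    rw [zero_pow hi0, zero_mul] at ha
    exact ha (zero_mem _)
  have hj0 : j = 0 := by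
    by_contra hj0
    rw [zero_pow hj0, zero_mul] at hb
    exact hb (zero_mem _)
  simp [hi0, hj0] at ht0

variable {k : Type*} [Field k] [Algebra k O]

/-- Reduction modulo m³ is just fine enough to retain the relation XY = 0 as xy ∈ m³. The
independence of x, y needs m not principal, which the zero divisors X, Y of the completion ensure.
-/
theorem exists_isNodePair [IsNoetherianRing O] [IsReduced O]
    (e : AdicCompletion (maximalIdeal O) O ≃ₐ[k] (MvPowerSeries (Fin 2) k ⧸
        Ideal.span {(MvPowerSeries.X 0 * MvPowerSeries.X 1 : MvPowerSeries (Fin 2) k)})) :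
    (∃ x y : O, IsNodePair x y) ∧ ∀ a : O, ∃ c : k, a - algebraMap k O c ∈ maximalIdeal O := by
  let I := Ideal.span {(MvPowerSeries.X 0 * MvPowerSeries.X 1 : MvPowerSeries (Fin 2) k)}
  let F : MvPowerSeries (Fin 2) k →ₐ[k] AdicCompletion (maximalIdeal O) O :=
    (e.symm : _ →ₐ[k] _).comp (Ideal.Quotient.mkₐ k I)
  have hFs : Function.Surjective F :=
    e.symm.surjective.comp (Ideal.Quotient.mkₐ_surjective k I)
  have hF0 : ∀ f, F f = 0 ↔ f ∈ I := fun f => by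
    rw [← Ideal.Quotient.eq_zero_iff_mem]
    exact e.symm.map_eq_zero_iff
  let ψ : MvPowerSeries (Fin 2) k →+* O ⧸ maximalIdeal O ^ 3 :=
    (AdicCompletion.evalₐ (maximalIdeal O) 3).toRingHom.comp F.toRingHom
  have hψs : Function.Surjective ψ := (AdicCompletion.surjective_evalₐ _ 3).comp hFs
  have hψC : ∀ c : k, ψ (MvPowerSeries.C c) = Ideal.Quotient.mk _ (algebraMap k O c) := by
    intro c
    have h1 : F (MvPowerSeries.C c) = algebraMap k _ c := F.commutes c
    have h2 : algebraMap k (AdicCompletion (maximalIdeal O) O) c =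
        algebraMap O _ (algebraMap k O c) := IsScalarTower.algebraMap_apply _ _ _ _
    change AdicCompletion.evalₐ (maximalIdeal O) 3 (F (MvPowerSeries.C c)) = _
    rw [h1, h2, AlgHom.commutes]
    rfl
  have hne : (maximalIdeal O ^ 3 : Ideal O) ≠ ⊤ := fun h =>
    (maximalIdeal.isMaximal O).ne_top (eq_top_iff.2 (h ▸ Ideal.pow_le_self three_ne_zero))
  have : Nontrivial (O ⧸ maximalIdeal O ^ 3) := Ideal.Quotient.nontrivial_iff.2 hne
  have hlift : ∀ i : Fin 2, ∃ x ∈ maximalIdeal O, ψ (MvPowerSeries.X i) =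
      Ideal.Quotient.mk _ x := by
    intro i
    obtain ⟨x, hx⟩ := Ideal.Quotient.mk_surjective (ψ (MvPowerSeries.X i))
    refine ⟨x, ?_, hx.symm⟩
    rw [mem_maximalIdeal]
    intro hu
    obtain ⟨g, hg⟩ := hψs (Ideal.Quotient.mk _ (hu.unit⁻¹ : Oˣ))
    have h1 : ψ (1 - MvPowerSeries.X i * g) = 0 := by
      rw [map_sub, map_one, map_mul, hg, ← hx, ← map_mul, IsUnit.mul_val_inv, map_one, sub_self]
    -- A lift of X that was a unit would send this unit power series to 0 in a nonzero ring; so X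
    -- lifts into m.
    have h2 : IsUnit (1 - MvPowerSeries.X i * g : MvPowerSeries (Fin 2) k) := by
      rw [MvPowerSeries.isUnit_iff_constantCoeff]
      simp
    exact (h2.map ψ).ne_zero h1
  obtain ⟨x, hx, hψx⟩ := hlift 0
  obtain ⟨y, hy, hψy⟩ := hlift 1
  have hdec : ∀ a : O, ∃ (c : k) (α β : O),
      a - algebraMap k O c - (α * x + β * y) ∈ maximalIdeal O ^ 3 := by
    intro a
    obtain ⟨f, hf⟩ := hψs (Ideal.Quotient.mk _ a)
    obtain ⟨g, h, e⟩ := MvPowerSeries.exists_eq_add_X_mul f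
    obtain ⟨α, hα⟩ := Ideal.Quotient.mk_surjective (ψ g)
    obtain ⟨β, hβ⟩ := Ideal.Quotient.mk_surjective (ψ h)
    refine ⟨MvPowerSeries.constantCoeff f, α, β, ?_⟩
    rw [← Ideal.Quotient.eq_zero_iff_mem]
    simp only [map_sub, map_add, map_mul]
    rw [← hf, ← hψC, hα, hβ, ← hψx, ← hψy]
    conv_lhs => enter [1, 1]; rw [e]
    simp only [map_add, map_mul]
    ring
  have hm3 : maximalIdeal O ^ 3 ≤ maximalIdeal O ^ 2 := Ideal.pow_le_pow_right (by lia)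
  have hm2 : maximalIdeal O ^ 2 ≤ maximalIdeal O := Ideal.pow_le_self two_ne_zero
  have hlin : ∀ α β : O, α * x + β * y ∈ maximalIdeal O := fun α β =>
    Ideal.add_mem _ (Ideal.mul_mem_left _ _ hx) (Ideal.mul_mem_left _ _ hy)
  have hconst : ∀ a : O, ∃ c : k, a - algebraMap k O c ∈ maximalIdeal O := by
    intro a
    obtain ⟨c, α, β, h⟩ := hdec a
    exact ⟨c, (Submodule.sub_mem_iff_left _ (hlin α β)).1 (hm2 (hm3 h))⟩
  have hdec' : ∀ a ∈ maximalIdeal O, ∃ α β : O, a - (α * x + β * y) ∈ maximalIdeal O ^ 2 := by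
    intro a ha
    obtain ⟨c, α, β, h⟩ := hdec a
    have hc : algebraMap k O c ∈ maximalIdeal O :=
      (Submodule.sub_mem_iff_right _ ha).1
        ((Submodule.sub_mem_iff_left _ (hlin α β)).1 (hm2 (hm3 h)))
    have hc0 : c = 0 := by
      by_contra hc0
      exact hc ((isUnit_iff_ne_zero.2 hc0).map (algebraMap k O))
    rw [hc0, map_zero, sub_zero] at h
    exact ⟨α, β, hm3 h⟩
  have hnak : ∀ J : Ideal O, J ≤ maximalIdeal O → maximalIdeal O ≤ J ⊔ maximalIdeal O ^ 2 →
      J = maximalIdeal O := by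
    intro J hJ h
    refine le_antisymm hJ (Submodule.le_of_le_smul_of_le_jacobson_bot (I := maximalIdeal O)
      (IsNoetherian.noetherian _) (maximalIdeal_le_jacobson _) ?_)
    rwa [smul_eq_mul, ← sq]
  have hnot : ∀ t : O, Ideal.span {t} ≠ maximalIdeal O := by
    intro t ht
    have h1 : F (MvPowerSeries.X 0) * F (MvPowerSeries.X 1) = 0 := by
      rw [← map_mul, hF0]
      exact Ideal.mem_span_singleton_self _
    rcases eq_zero_or_eq_zero_of_mul ht h1 with h | h
    · exact MvPowerSeries.X_notMem_span zero_ne_one ((hF0 _).1 h)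
    · have h2 := (hF0 _).1 h
      simp only [I] at h2
      rw [mul_comm] at h2
      exact MvPowerSeries.X_notMem_span one_ne_zero h2
  have hindep : ∀ (x y : O) (_ : x ∈ maximalIdeal O) (_ : y ∈ maximalIdeal O)
      (_ : ∀ a ∈ maximalIdeal O, ∃ α β : O, a - (α * x + β * y) ∈ maximalIdeal O ^ 2)
      (a b : O) (_ : a * x + b * y ∈ maximalIdeal O ^ 2), a ∈ maximalIdeal O := by
    intro x y hx hy hdec' a b hab
    by_contra ha
    rw [mem_maximalIdeal, mem_nonunits_iff, not_not] at ha
    obtain ⟨a', ha'⟩ := ha.exists_left_inv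
    -- A relation in m² with unit coefficient at x would make m = (y) + m², hence principal by
    -- Nakayama.
    refine hnot y (hnak _ ((Ideal.span_singleton_le_iff_mem _).2 hy) fun w hw => ?_)
    obtain ⟨α, β, h⟩ := hdec' w hw
    have h2 : w = (β - α * a' * b) * y +
        ((w - (α * x + β * y)) + α * a' * (a * x + b * y)) := by
      linear_combination -(α * x) * ha'
    rw [h2]
    exact Submodule.add_mem_sup (Ideal.mem_span_singleton'.2 ⟨_, rfl⟩)
      (Ideal.add_mem _ h (Ideal.mul_mem_left _ _ hab))
  refine ⟨⟨x, y, ?_, ?_, fun a b hab => ⟨hindep x y hx hy hdec' a b hab,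
    hindep y x hy hx (fun w hw => ?_) b a (by rwa [add_comm])⟩⟩, hconst⟩
  · refine hnak _ ?_ fun a ha => ?_
    · rw [Ideal.span_le]
      rintro _ (rfl | rfl)
      exacts [hx, hy]
    · obtain ⟨α, β, h⟩ := hdec' a ha
      rw [← add_sub_cancel (α * x + β * y) a]
      exact Submodule.add_mem_sup (Ideal.mem_span_pair.2 ⟨α, β, rfl⟩) h
  · rw [← Ideal.Quotient.eq_zero_iff_mem, map_mul, ← hψx, ← hψy, ← map_mul]
    have : F (MvPowerSeries.X 0 * MvPowerSeries.X 1) = 0 :=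
      (hF0 _).2 (Ideal.mem_span_singleton_self _)
    change AdicCompletion.evalₐ (maximalIdeal O) 3 (F _) = 0
    rw [this, map_zero]
  · obtain ⟨α, β, h⟩ := hdec' w hw
    exact ⟨β, α, by rwa [add_comm (β * y)]⟩

end Completion

/-! ## Local rings of a curve -/

section Scheme

open IsLocalRing

variable {k : Type u} [Field k] {C : Over (Spec (CommRingCat.of k))}

theorem toFunField_germ {ξ x : C.left} (h : ξ ⤳ x) (U : C.left.Opens) (hxU : x ∈ U)
    (a : Γ(C.left, U)) :
    toFunField C h (C.left.presheaf.germ U x hxU a) =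
      C.left.evaluation U ξ (h.mem_open U.2 hxU) a := by
  have e : C.left.presheaf.germ U x hxU ≫ C.left.presheaf.stalkSpecializes h ≫ C.left.residue ξ =
      C.left.evaluation U ξ (h.mem_open U.2 hxU) := by
    rw [← Category.assoc, TopCat.Presheaf.germ_stalkSpecializes]
    rfl
  exact congrArg (fun φ => CommRingCat.Hom.hom φ a) e

theorem exists_germ_eq (x : C.left) (a : LocRing C x) :
    ∃ (U : C.left.Opens) (hxU : x ∈ U) (s : Γ(C.left, U)), C.left.presheaf.germ U x hxU s = a :=
  TopCat.Presheaf.exists_germ_eq C.left.presheaf a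

theorem essFiniteType_locRing [LocallyOfFiniteType C.hom] (x : C.left) :
    Algebra.EssFiniteType k (LocRing C x) := by
  obtain ⟨_, ⟨U : C.left.Opens, hU, rfl⟩, hxU, -⟩ :=
    C.left.isBasis_affineOpens.exists_subset_of_mem_open (Set.mem_univ x) isOpen_univ
  have h1 : (C.hom.appLE ⊤ U le_top).hom.FiniteType :=
    C.hom.finiteType_appLE (isAffineOpen_top _) hU _
  have h2 : (C.left.presheaf.germ U x hxU).hom.EssFiniteType := by
    let := C.left.presheaf.algebra_section_stalk ⟨x, hxU⟩
    have := hU.isLocalization_stalk ⟨x, hxU⟩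
    exact RingHom.EssFiniteType.holdsForLocalization _
      (hU.primeIdealOf ⟨x, hxU⟩).asIdeal.primeCompl
  have h3 : (Scheme.ΓSpecIso (CommRingCat.of k)).inv.hom.EssFiniteType :=
    (RingHom.FiniteType.of_surjective _
      (Scheme.ΓSpecIso (CommRingCat.of k)).symm.commRingCatIsoToRingEquiv.surjective).essFiniteType
  have h4 := (h3.comp h1.essFiniteType).comp h2
  have e : (Scheme.ΓSpecIso (CommRingCat.of k)).inv ≫ C.hom.appTop ≫
      C.left.presheaf.germ ⊤ x trivial = ((Scheme.ΓSpecIso (CommRingCat.of k)).inv ≫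
        C.hom.appLE ⊤ U le_top) ≫ C.left.presheaf.germ U x hxU := by
    rw [Category.assoc]
    delta Scheme.Hom.appLE
    rw [Category.assoc, TopCat.Presheaf.germ_res]
    rfl
  have e' : algebraMap k (LocRing C x) = _ := congrArg CommRingCat.Hom.hom e
  rw [← RingHom.essFiniteType_algebraMap, e']
  exact h4

/-- The stalk at ξ is a localization of the sections over an affine neighbourhood of x, and those
sections already have germs at x. -/
theorem toFunField_frac {ξ x : C.left} (h : ξ ⤳ x) (g : FunField C ξ) :
    ∃ a b, toFunField C h b ≠ 0 ∧ g = toFunField C h a / toFunField C h b := by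
  obtain ⟨_, ⟨U : C.left.Opens, hU, rfl⟩, hxU, -⟩ :=
    C.left.isBasis_affineOpens.exists_subset_of_mem_open (Set.mem_univ x) isOpen_univ
  have hξU : ξ ∈ U := h.mem_open U.2 hxU
  obtain ⟨s, rfl⟩ := C.left.residue_surjective ξ g
  let := C.left.presheaf.algebra_section_stalk ⟨ξ, hξU⟩
  have := hU.isLocalization_stalk ⟨ξ, hξU⟩
  obtain ⟨⟨a, b⟩, e⟩ := IsLocalization.surj (hU.primeIdealOf ⟨ξ, hξU⟩).asIdeal.primeCompl s
  have hb := IsLocalization.map_units (C.left.presheaf.stalk ξ) b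
  have e1 := congrArg (C.left.residue ξ) e
  rw [map_mul] at e1
  have hb1 := (hb.map (C.left.residue ξ).hom).ne_zero
  refine ⟨C.left.presheaf.germ U x hxU a, C.left.presheaf.germ U x hxU b.1, ?_, ?_⟩
  · rw [toFunField_germ]
    exact hb1
  · rw [toFunField_germ, toFunField_germ]
    exact (eq_div_of_mul_eq hb1 e1 : (_ : C.left.residueField ξ) = _)

theorem specializes_of_ker_le {ξ ξ' x : C.left} (h : ξ ⤳ x) (h' : ξ' ⤳ x)
    (hle : RingHom.ker (toFunField C h) ≤ RingHom.ker (toFunField C h')) : ξ ⤳ ξ' := by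
  obtain ⟨_, ⟨U : C.left.Opens, hU, rfl⟩, hxU, -⟩ :=
    C.left.isBasis_affineOpens.exists_subset_of_mem_open (Set.mem_univ x) isOpen_univ
  rw [specializes_iff_forall_open]
  intro W hW hξ'W
  obtain ⟨f, hf, hξ'f⟩ := hU.exists_basicOpen_le (V := ⟨W, hW⟩) ⟨ξ', hξ'W⟩ (h'.mem_open U.2 hxU)
  refine hf ?_
  rw [← Scheme.evaluation_ne_zero_iff_mem_basicOpen _ _ (h'.mem_open U.2 hxU),
    ← toFunField_germ h' U hxU] at hξ'f
  rw [← Scheme.evaluation_ne_zero_iff_mem_basicOpen _ _ (h.mem_open U.2 hxU),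
    ← toFunField_germ h U hxU]
  exact fun h0 => hξ'f (hle h0)

/-- A prime of the stalk is a generization y of x; the generic point of a component through y does
it, as a section vanishing there cannot be nonzero at y. -/
theorem exists_ker_toFunField_le {x : C.left} (p : Ideal (LocRing C x)) (hp : p.IsPrime) :
    ∃ ξ : {ξ : genericPoints C.left // (ξ : C.left) ⤳ x}, RingHom.ker (toFunField C ξ.2) ≤ p := by
  let P : Spec (C.left.presheaf.stalk x) := ⟨p, hp⟩
  let y := C.left.fromSpecStalk x P
  have hyx : y ⤳ x := by
    have : y ∈ Set.range (C.left.fromSpecStalk x) := ⟨P, rfl⟩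
    rwa [Scheme.range_fromSpecStalk] at this
  let ξ := genericPoints.ofComponent ⟨irreducibleComponent y,
    irreducibleComponent_mem_irreducibleComponents y⟩
  have hξy : (ξ : C.left) ⤳ y :=
    (genericPoints.isGenericPoint_ofComponent _).specializes mem_irreducibleComponent
  refine ⟨⟨ξ, hξy.trans hyx⟩, fun a ha => ?_⟩
  obtain ⟨U, hxU, s, rfl⟩ := exists_germ_eq x a
  have hs : (ξ : C.left) ∉ C.left.basicOpen s := by
    rw [← Scheme.evaluation_ne_zero_iff_mem_basicOpen _ _ ((hξy.trans hyx).mem_open U.2 hxU),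
      ← toFunField_germ (hξy.trans hyx), not_not]
    exact ha
  have hys : y ∉ C.left.basicOpen s := fun hy => hs (hξy.mem_open (C.left.basicOpen s).2 hy)
  by_contra hap
  apply hys
  change P ∈ (C.left.fromSpecStalk x) ⁻¹ᵁ C.left.basicOpen s
  rw [Scheme.preimage_basicOpen, Scheme.fromSpecStalk_app hxU]
  simp only [CommRingCat.comp_apply]
  rw [Scheme.basicOpen_res]
  refine ⟨hyx.mem_open U.2 hxU, ?_⟩
  rw [basicOpen_eq_of_affine]
  exact hap

theorem isCurveGerm_toFunField (C : Over (Spec (CommRingCat.of k))) (x : C.left) :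
    IsCurveGerm (ι := {ξ : genericPoints C.left // (ξ : C.left) ⤳ x})
      (K := fun ξ => FunField C ξ.1) fun ξ => toFunField C ξ.2 where
  frac ξ g := toFunField_frac ξ.2 g
  eq_of_ker_le ξ ξ' hle := by
    have h1 := specializes_of_ker_le ξ.2 ξ'.2 hle
    have h2 : closure {(ξ'.1 : C.left)} ⊆ closure {(ξ.1 : C.left)} :=
      specializes_iff_closure_subset.1 h1
    have h3 : closure {(ξ.1 : C.left)} ⊆ closure {(ξ'.1 : C.left)} :=
      ξ'.1.2.2 ξ.1.2.1 h2
    exact Subtype.ext (Subtype.ext (h1.antisymm (specializes_iff_closure_subset.2 h3)).eq)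
  exists_ker_le p hp := exists_ker_toFunField_le p hp

/-- The Nullstellensatz: the residue field at a closed point is k. -/
theorem exists_sub_algebraMap_mem [IsAlgClosed k] [LocallyOfFiniteType C.hom] {x : C.left}
    (hx : IsClosed ({x} : Set C.left)) (a : LocRing C x) :
    ∃ c : k, a - algebraMap k (LocRing C x) c ∈ maximalIdeal (LocRing C x) := by
  have e : (Scheme.ΓSpecIso (CommRingCat.of k)).inv ≫ C.hom.appTop ≫
      C.left.presheaf.germ ⊤ x trivial ≫ C.left.residue x =
        (residueFieldIsoBase C.hom x hx).inv := by
    apply Spec.map_injective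
    rw [SpecMap_residueFieldIsoBase_inv]
    simp only [Spec.map_comp, Category.assoc, ← Scheme.fromSpecStalk_toSpecΓ,
      ← Scheme.toSpecΓ_naturality_assoc, toSpecΓ_SpecMap_ΓSpecIso_inv]
    simp [Scheme.fromSpecResidueField]
  let c : k := (residueFieldIsoBase C.hom x hx).hom (C.left.residue x a)
  have hc : (residueFieldIsoBase C.hom x hx).inv c = C.left.residue x a := by
    simp [c]
  refine ⟨c, ?_⟩
  rw [← IsLocalRing.residue_eq_zero_iff, map_sub, sub_eq_zero]
  rw [← e] at hc
  exact hc.symm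

end Scheme

/-! ## Differentials at a point of a curve -/

section Curve

open IsLocalRing

variable {k : Type u} [Field k] {C : Over (Spec (CommRingCat.of k))} {x : C.left}

theorem Branch.dominates (P : Branch C x) : Dominates (toFunField C P.specializes) P.V where
  le_one a := (P.V.valuation_le_one_iff _).2 (P.map_mem a)
  lt_one a ha := P.V.mem_nonunits_iff.1 (P.map_nonunit a ha)

/-- The point of the normalization given by a dominating valuation ring. -/
def Dominates.branch {ξ : genericPoints C.left} {h : (ξ : C.left) ⤳ x}
    {V : ValuationSubring (FunField C ξ)} (hV : Dominates (toFunField C h) V) : Branch C x where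
  pt := ξ
  specializes := h
  V := V
  map_mem a := (V.valuation_le_one_iff _).1 (hV.le_one a)
  map_nonunit a ha := V.mem_nonunits_iff.2 (hV.lt_one a ha)

theorem Branch.frac (P : Branch C x) (g : FunField C P.pt) :
    ∃ a b, toFunField C P.specializes b ≠ 0 ∧
      g = toFunField C P.specializes a / toFunField C P.specializes b :=
  toFunField_frac P.specializes g

/-- Every regular function at a place is approximated by functions in the local ring. -/
theorem exists_approx {k O K : Type u} [Field k] [CommRing O] [Algebra k O] [Field K]
    [Algebra k K] {V : ValuationSubring K} (hV : IsRationalPlace k V) {φ : O →+* K}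
    (hφ : ∀ c : k, φ (algebraMap k O c) = algebraMap k K c) {z : O} (hz : IsUniformizer V (φ z))
    (N : ℕ) {v : K} (hv : V.valuation v ≤ 1) :
    ∃ p, V.valuation (v - φ p) ≤ V.valuation (φ z) ^ N := by
  induction N generalizing v with
  | zero => exact ⟨0, by simpa using hv⟩
  | succ N ih =>
    obtain ⟨c, hc⟩ := hV.exists_const v hv
    obtain ⟨p, hp⟩ := ih (hz.div_le hc)
    refine ⟨algebraMap k O c + z * p, ?_⟩
    have e : v - φ (algebraMap k O c + z * p) =
        φ z * ((v - algebraMap k K c) / φ z - φ p) := by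
      have := hz.ne_zero
      rw [map_add, map_mul, hφ]
      field_simp
      ring
    rw [e, map_mul, pow_succ']
    gcongr

/-! ### The two points above a node: conductor, poles and residues -/

variable (C x) in
/-- A pair of generators of the maximal ideal at a node, with the two points above the node. -/
structure NodeData (a b : LocRing C x) (P Q : Branch C x) : Prop where
  noetherian : IsNoetherianRing (LocRing C x)
  reduced : IsReduced (LocRing C x)
  pair : IsNodePair a b
  left : IsFirstBranch (toFunField C P.specializes) P.V a b
  right : IsFirstBranch (toFunField C Q.specializes) Q.V b a
  left_place : IsRationalPlace k P.V
  right_place : IsRationalPlace k Q.V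
  const : ∀ a : LocRing C x, ∃ c : k, a - algebraMap k _ c ∈ maximalIdeal (LocRing C x)
  ne : P ≠ Q
  eq_or_eq : ∀ R : Branch C x, R = P ∨ R = Q

/-- The two points are the places where a/(a + b), respectively b/(a + b), is a nonunit; both cannot
be nonunits, and by `Dominates.lt_or_lt` one always is. -/
theorem IsNode.exists_nodeData [IsAlgClosed k] [CharZero k] [LocallyOfFiniteType C.hom]
    [IsReduced C.left] (hx : IsNode C x) : ∃ a b P Q, NodeData C x a b P Q := by
  have hess := essFiniteType_locRing (k := k) x
  have hN : IsNoetherianRing (LocRing C x) := Algebra.EssFiniteType.isNoetherianRing k _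
  have hR : IsReduced (LocRing C x) :=
    inferInstanceAs (IsReduced (C.left.presheaf.stalk x))
  obtain ⟨e⟩ := hx.2
  obtain ⟨⟨a, b, h⟩, hconst⟩ := exists_isNodePair e
  have hφ := isCurveGerm_toFunField C x
  obtain ⟨i, V, hV⟩ := hφ.exists_isFirstBranch h
  obtain ⟨j, W, hW⟩ := hφ.exists_isFirstBranch h.symm
  have huniq : ∀ {a b : LocRing C x} (_ : IsNodePair a b) (P Q : Branch C x)
      (_ : IsFirstBranch (toFunField C P.specializes) P.V a b)
      (_ : IsFirstBranch (toFunField C Q.specializes) Q.V a b), P = Q := by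
    intro a b h P Q hP hQ
    obtain ⟨ξ, hξ, V, h1, h2⟩ := P
    obtain ⟨ξ', hξ', V', h1', h2'⟩ := Q
    obtain rfl : ξ = ξ' := congrArg Subtype.val
      (hφ.isFirstBranch_index_eq (i := ⟨ξ, hξ⟩) (j := ⟨ξ', hξ'⟩) h hP hQ)
    obtain rfl : V = V' := hφ.isFirstBranch_eq (i := ⟨ξ, hξ⟩) h hP hQ
    rfl
  refine ⟨a, b, hV.toDominates.branch, hW.toDominates.branch, hN, hR, h, hV, hW,
    hV.isRationalPlace (fun c => toFunField_algebraMap C i.2 c) h hconst (hφ.frac i),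
    hW.isRationalPlace (fun c => toFunField_algebraMap C j.2 c) h.symm hconst (hφ.frac j), hconst,
    fun hPQ => ?_, fun R => ?_⟩
  · have h1 : IsFirstBranch (toFunField C hV.toDominates.branch.specializes)
        hV.toDominates.branch.V a b := hV
    rw [hPQ] at h1
    exact h1.not_swap hW
  · rcases R.dominates.lt_or_lt h (hφ.add_ne_zero h ⟨R.pt, R.specializes⟩) with h1 | h1
    · exact Or.inl (huniq h _ _ ⟨R.dominates, h1⟩ hV)
    · exact Or.inr (huniq h.symm _ _ ⟨R.dominates, by rwa [add_comm]⟩ hW)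

namespace NodeData

variable {a b : LocRing C x} {P Q : Branch C x}

theorem symm (h : NodeData C x a b P Q) : NodeData C x b a Q P where
  noetherian := h.noetherian
  reduced := h.reduced
  pair := h.pair.symm
  left := h.right
  right := h.left
  left_place := h.right_place
  right_place := h.left_place
  const := h.const
  ne := h.ne.symm
  eq_or_eq R := (h.eq_or_eq R).symm

/-- For q integral, (a + b)q comes from m; multiplying by c ∈ m lands in m² = (a + b)m, and a + b
cancels, so cq comes from O. -/
theorem maximalIdeal_le_conductor (h : NodeData C x a b P Q) :
    maximalIdeal (LocRing C x) ≤ conductor C x := by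
  have := h.noetherian
  have := h.reduced
  have hφ := isCurveGerm_toFunField C x
  have hint : ∀ (R : Branch C x) (q : RatAt C x), (toRatAt C x).IsIntegralElem q →
      R.V.valuation (q ⟨R.pt, R.specializes⟩) ≤ 1 := by
    rintro R q ⟨p, hp, hpq⟩
    rw [R.V.valuation_le_one_iff]
    let ψ : LocRing C x →+* R.V := (toFunField C R.specializes).codRestrict R.V R.map_mem
    have h1 : IsIntegral R.V (q ⟨R.pt, R.specializes⟩) := by
      refine ⟨p.map ψ, hp.map ψ, ?_⟩
      rw [Polynomial.eval₂_map]
      have h2 := congrArg (Pi.evalRingHom _ (⟨R.pt, R.specializes⟩ :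
        {ξ : genericPoints C.left // (ξ : C.left) ⤳ x})) hpq
      rw [Polynomial.hom_eval₂] at h2
      exact h2
    obtain ⟨v, hv⟩ := IsIntegrallyClosed.isIntegral_iff.1 h1
    rw [← hv]
    exact v.2
  intro c hc q hq
  obtain ⟨a₀, ha₀, e⟩ := hφ.exists_mul_eq_of_integral (i := ⟨P.pt, P.specializes⟩)
    (j := ⟨Q.pt, Q.specializes⟩) h.pair h.left h.right (hint P q hq) (hint Q q hq)
  have h2 : c * a₀ ∈ maximalIdeal (LocRing C x) ^ (1 + 0 + 1) := by
    rw [add_zero, pow_add, pow_one]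
    exact Ideal.mul_mem_mul hc ha₀
  obtain ⟨d, -, e'⟩ := h.pair.exists_of_mem_pow_succ 1 0 h2
  refine ⟨d, funext fun ξ => ?_⟩
  have h3 := congrArg (toFunField C ξ.2) e'
  rw [map_mul, map_mul, pow_one, e, mul_left_comm] at h3
  exact (mul_left_cancel₀ (hφ.add_ne_zero h.pair ξ) h3).symm

/-- The function a/(a + b) is integral. If it were d ∈ O, then (1 − d)a − db = 0, and independence
would put both 1 − d and d in m. -/
theorem conductor_eq (h : NodeData C x a b P Q) :
    conductor C x = maximalIdeal (LocRing C x) := by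
  have := h.noetherian
  have := h.reduced
  have hφ := isCurveGerm_toFunField C x
  refine le_antisymm (le_maximalIdeal fun htop => ?_) h.maximalIdeal_le_conductor
  have h1 : (1 : LocRing C x) ∈ conductor C x := htop ▸ Submodule.mem_top
  obtain ⟨c, hc, e⟩ := h.pair.exists_mul_eq
  let q : RatAt C x := fun ξ => toFunField C ξ.2 a / toFunField C ξ.2 (a + b)
  have hq : (toRatAt C x).IsIntegralElem q := by
    refine ⟨Polynomial.X ^ 2 - Polynomial.X + Polynomial.C c, by monicity!, funext fun ξ => ?_⟩
    rw [Polynomial.eval₂_add, Polynomial.eval₂_sub, Polynomial.eval₂_pow, Polynomial.eval₂_X,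
      Polynomial.eval₂_C]
    change q ξ ^ 2 - q ξ + toFunField C ξ.2 c = 0
    have h0 := hφ.add_ne_zero h.pair ξ
    have h2 := congrArg (toFunField C ξ.2) e
    simp only [q]
    simp only [map_mul, map_pow, map_add] at h0 h2 ⊢
    field_simp
    linear_combination -h2
  obtain ⟨d, hd⟩ := h1 q hq
  have h3 : a - d * (a + b) = 0 := hφ.eq_zero fun ξ => by
    have h4 := congrFun hd ξ
    rw [map_one, one_mul] at h4
    have h5 : toFunField C ξ.2 d = toFunField C ξ.2 a / toFunField C ξ.2 (a + b) := h4
    rw [map_sub, map_mul, h5, div_mul_cancel₀ _ (hφ.add_ne_zero h.pair ξ), sub_self]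
  have h6 := h.pair.indep (1 - d) (-d) (by
    have : (1 - d) * a + -d * b = a - d * (a + b) := by ring
    rw [this, h3]
    exact zero_mem _)
  have h7 := Ideal.sub_mem _ h6.1 h6.2
  rw [sub_neg_eq_add, sub_add_cancel] at h7
  exact (Ideal.ne_top_iff_one _).1 (maximalIdeal.isMaximal _).ne_top h7

theorem isUniformizer (h : NodeData C x a b P Q) :
    IsUniformizer P.V (toFunField C P.specializes (a + b)) :=
  have := h.noetherian
  h.left.isUniformizer h.pair P.frac

theorem resPairing_apply (h : NodeData C x a b P Q) (f : LocRing C x) (η : MeroForms C) :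
    resPairing x f η = residue k P.V (germMul f P η) + residue k Q.V (germMul f Q η) := by
  classical
  rw [resPairing, finsum_eq_sum_of_support_subset (s := {P, Q}), Finset.sum_pair h.ne]
  · rfl
  · intro R _
    simpa using h.eq_or_eq R

/-- A differential has at most a simple pole as soon as multiplication by `a + b` makes it
regular. -/
theorem hasAtMostSimplePole (h : NodeData C x a b P Q) {η : MeroForms C}
    (hη : germMul (a + b) P η ∈ regularForms k P.V) : HasAtMostSimplePole P η := by
  intro t ht
  have h1 := h.left_place.smul_mem_regularForms hη
    (h.isUniformizer.div_le (P.V.mem_nonunits_iff.1 ht))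
  have h2 : germMul (a + b) P η = toFunField C P.specializes (a + b) • η P.pt := rfl
  rwa [h2, smul_smul, div_mul_cancel₀ _ h.isUniformizer.ne_zero] at h1

theorem hasAtMostSimplePole_of_dualizing (h : NodeData C x a b P Q) {η : MeroForms C}
    (hη : η ∈ dualizingAt C x) : HasAtMostSimplePole P η := by
  have := h.noetherian
  have hu := h.isUniformizer
  refine h.hasAtMostSimplePole (h.left_place.mem_regularForms_of_residue fun v hv => ?_)
  set φ := toFunField C P.specializes with hφdef
  set ψ := toFunField C Q.specializes with hψdef
  have hzQ : ψ (b + a) ≠ 0 := h.right.ne_zero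
  have hs : Q.V.valuation (ψ b / ψ (b + a)) < 1 := by
    rw [map_div₀, div_lt_one₀ h.right.pos]
    exact h.right.lt
  have hw : P.V.valuation (φ b / φ (a + b)) = 1 := by
    rw [map_div₀, h.left.right_eq, div_self h.left.pos.ne']
  obtain ⟨N, hN⟩ := h.left_place.exists_pow_smul_mem hu.lt_one (η P.pt)
  obtain ⟨M, hM⟩ := h.right_place.exists_pow_smul_mem hs (η Q.pt)
  -- The test function d = (a + b)(b/(a + b))^M: it lies in O because m^(M+1) = (a + b)^M m, it
  -- cancels the pole at Q, and at P it is a + b times a unit.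
  have hmem : (a + b) * b ^ M ∈ maximalIdeal (LocRing C x) ^ (M + 0 + 1) := by
    rw [add_zero, pow_succ']
    exact Ideal.mul_mem_mul h.pair.add_mem (Ideal.pow_mem_pow h.pair.right_mem M)
  obtain ⟨d, -, e⟩ := h.pair.exists_of_mem_pow_succ M 0 hmem
  have hPd : φ d = φ (a + b) * (φ b / φ (a + b)) ^ M := by
    have h1 := congrArg φ e
    rw [map_mul, map_mul, map_pow, map_pow] at h1
    rw [div_pow, mul_div_assoc', h1, mul_div_cancel_left₀ _ (pow_ne_zero M hu.ne_zero)]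
  have hQd : ψ d = ψ (b + a) * (ψ b / ψ (b + a)) ^ M := by
    have h1 := congrArg ψ e
    rw [map_mul, map_mul, map_pow, map_pow, add_comm a b] at h1
    rw [div_pow, mul_div_assoc', h1, mul_div_cancel_left₀ _ (pow_ne_zero M hzQ)]
  have hw0 : (φ b / φ (a + b)) ^ M ≠ 0 := by
    refine pow_ne_zero M ((Valuation.ne_zero_iff P.V.valuation).1 ?_)
    rw [hw]
    exact one_ne_zero
  have hv' : P.V.valuation (v / (φ b / φ (a + b)) ^ M) ≤ 1 := by
    rw [map_div₀, map_pow, hw, one_pow, div_one]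
    exact hv
  -- Dividing v by that unit before approximating makes dp agree with v(a + b) to order N at P, so
  -- the pairing with dp isolates the residue of v(a + b)η at P.
  obtain ⟨p, hp⟩ := exists_approx h.left_place
    (fun c => toFunField_algebraMap C P.specializes c) hu N hv'
  have hQ0 : residue k Q.V (germMul (d * p) Q η) = 0 := by
    refine h.right_place.residue_eq_zero (hM _ ?_)
    change Q.V.valuation (ψ (d * p)) ≤ _
    rw [map_mul, map_mul, hQd, map_mul, map_pow]
    refine (mul_le_of_le_one_right' (h.right.le_one p)).trans (mul_le_of_le_one_left' ?_)
    exact h.right.le_one _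
  have hP0 : residue k P.V (germMul (d * p) P η) = 0 := by
    have h1 := (Submodule.mem_iInf _).1 hη (d * p)
    rw [LinearMap.mem_ker, h.resPairing_apply, hQ0, add_zero] at h1
    exact h1
  have hdiff : residue k P.V ((v * φ (a + b) - φ (d * p)) • η P.pt) = 0 := by
    refine h.left_place.residue_eq_zero (hN _ ?_)
    have e1 : v * φ (a + b) - φ (d * p) = φ (a + b) * (φ b / φ (a + b)) ^ M *
        (v / (φ b / φ (a + b)) ^ M - φ p) := by
      rw [mul_sub, map_mul, hPd, mul_assoc (φ (a + b)) _ (v / _), mul_div_cancel₀ _ hw0, mul_comm v]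
    rw [e1, map_mul, map_mul, map_pow, hw, one_pow, mul_one]
    exact (mul_le_of_le_one_left' hu.lt_one.le).trans hp
  rw [sub_smul, map_sub, sub_eq_zero] at hdiff
  change residue k P.V (v • φ (a + b) • η P.pt) = 0
  rw [smul_smul, hdiff]
  exact hP0

theorem residue_germMul (h : NodeData C x a b P Q) {η : MeroForms C}
    (hη : HasAtMostSimplePole P η) {f : LocRing C x} {c : k}
    (hc : f - algebraMap k _ c ∈ maximalIdeal (LocRing C x)) :
    residue k P.V (germMul f P η) = c * res P η := by
  refine h.left_place.residue_smul_of_simple_pole hη ?_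
  have h1 := h.left.lt_one _ hc
  rwa [map_sub, toFunField_algebraMap] at h1

theorem mem_dualizingAt (h : NodeData C x a b P Q) {η : MeroForms C} :
    η ∈ dualizingAt C x ↔
      HasAtMostSimplePole P η ∧ HasAtMostSimplePole Q η ∧ res P η + res Q η = 0 := by
  have key : ∀ {f : LocRing C x} {c : k}, f - algebraMap k _ c ∈ maximalIdeal (LocRing C x) →
      HasAtMostSimplePole P η → HasAtMostSimplePole Q η →
      resPairing x f η = c * (res P η + res Q η) := fun hc hP hQ => by
    rw [h.resPairing_apply, h.residue_germMul hP hc, h.symm.residue_germMul hQ hc, mul_add]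
  constructor
  · intro hη
    have hP := h.hasAtMostSimplePole_of_dualizing hη
    have hQ := h.symm.hasAtMostSimplePole_of_dualizing hη
    refine ⟨hP, hQ, ?_⟩
    have h1 := (Submodule.mem_iInf _).1 hη 1
    rw [LinearMap.mem_ker, key (c := 1) (by simp) hP hQ, one_mul] at h1
    exact h1
  · rintro ⟨hP, hQ, h0⟩
    refine (Submodule.mem_iInf _).2 fun f => ?_
    obtain ⟨c, hc⟩ := h.const f
    rw [LinearMap.mem_ker, key hc hP hQ, h0, mul_zero]

theorem mem_allowedAt (h : NodeData C x a b P Q) {η : MeroForms C} :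
    η ∈ allowedAt C x ↔ HasAtMostSimplePole P η ∧ HasAtMostSimplePole Q η := by
  simp only [allowedAt, h.conductor_eq, Submodule.mem_iInf, Submodule.mem_comap]
  constructor
  · intro hη
    exact ⟨h.hasAtMostSimplePole (hη _ h.pair.add_mem P),
      h.symm.hasAtMostSimplePole (hη _ h.symm.pair.add_mem Q)⟩
  · rintro ⟨hP, hQ⟩ f hf R
    rcases h.eq_or_eq R with rfl | rfl
    · exact hP _ (R.map_nonunit f hf)
    · exact hQ _ (R.map_nonunit f hf)

theorem dualizingAt_le_allowedAt (h : NodeData C x a b P Q) : dualizingAt C x ≤ allowedAt C x :=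
  fun _ hη => h.mem_allowedAt.2 ⟨(h.mem_dualizingAt.1 hη).1, (h.mem_dualizingAt.1 hη).2.1⟩

theorem mem_balancedAt (h : NodeData C x a b P Q) {η : MeroForms C} :
    η ∈ balancedAt C x ↔
      HasAtMostSimplePole P η ∧ HasAtMostSimplePole Q η ∧ res P η + res Q η = 0 := by
  rw [← h.mem_dualizingAt]
  exact ⟨fun hη => hη.2, fun hη => ⟨h.dualizingAt_le_allowedAt hη, hη⟩⟩

theorem mem_regularAt (h : NodeData C x a b P Q) {η : MeroForms C} :
    η ∈ regularAt C x ↔ η P.pt ∈ regularForms k P.V ∧ η Q.pt ∈ regularForms k Q.V := by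
  simp only [regularAt, Submodule.mem_iInf, Submodule.mem_comap, LinearMap.proj_apply]
  refine ⟨fun hη => ⟨hη P, hη Q⟩, fun hη R => ?_⟩
  rcases h.eq_or_eq R with rfl | rfl
  exacts [hη.1, hη.2]

/-- There is a differential with a simple pole and residue `1` at one of the two points, and
regular at the other. -/
theorem exists_form (h : NodeData C x a b P Q) :
    ∃ η : MeroForms C, HasAtMostSimplePole P η ∧ res P η = 1 ∧ η Q.pt ∈ regularForms k Q.V := by
  classical
  obtain ⟨ω, hω, hω1⟩ := h.left_place.exists_simple_pole
  let η₀ : MeroForms C := Pi.single P.pt ω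
  have hs : Q.V.valuation (toFunField C Q.specializes b /
      toFunField C Q.specializes (b + a)) < 1 := by
    rw [map_div₀, div_lt_one₀ h.right.pos]
    exact h.right.lt
  have hw : P.V.valuation (toFunField C P.specializes b /
      toFunField C P.specializes (b + a)) = 1 := by
    rw [add_comm b a, map_div₀, h.left.right_eq, div_self h.left.pos.ne']
  obtain ⟨M, hM⟩ := h.right_place.exists_pow_smul_mem hs (η₀ Q.pt)
  -- P and Q may lie on the same component, so a form supported on the component of P may have poles
  -- at Q. Powers of b/(a + b) remove them and are units at P; the constant c below restores residue
  -- 1.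
  let η : MeroForms C := fun ξ => if hξ : (ξ : C.left) ⤳ x then
    (toFunField C hξ b / toFunField C hξ (b + a)) ^ M • η₀ ξ else 0
  have hηP : η P.pt = (toFunField C P.specializes b /
      toFunField C P.specializes (b + a)) ^ M • ω := by
    simp only [η, dif_pos P.specializes, η₀, Pi.single_eq_same]
  have hηQ : η Q.pt = (toFunField C Q.specializes b / toFunField C Q.specializes (b + a)) ^ M •
      η₀ Q.pt := by
    simp only [η, dif_pos Q.specializes]
  have hwM : P.V.valuation ((toFunField C P.specializes b /
      toFunField C P.specializes (b + a)) ^ M) = 1 := by rw [map_pow, hw, one_pow]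
  obtain ⟨c, hc⟩ := h.left_place.exists_const _ hwM.le
  have hc0 : c ≠ 0 := by
    rintro rfl
    rw [map_zero, sub_zero, hwM] at hc
    exact hc.false
  refine ⟨c⁻¹ • η, fun t ht => ?_, ?_, ?_⟩
  · rw [Pi.smul_apply, hηP, smul_comm t c⁻¹, smul_comm t]
    exact Submodule.smul_mem _ _ (h.left_place.smul_mem_regularForms (hω t ht) hwM.le)
  · change residue k P.V (c⁻¹ • η P.pt) = 1
    rw [map_smul, hηP, h.left_place.residue_smul_of_simple_pole hω hc, hω1, mul_one, smul_eq_mul,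
      inv_mul_cancel₀ hc0]
  · rw [Pi.smul_apply, hηQ]
    exact Submodule.smul_mem _ _ (hM _ (by rw [map_pow]))

theorem regular_iff (h : NodeData C x a b P Q) {η : MeroForms C} (hη : HasAtMostSimplePole P η) :
    η P.pt ∈ regularForms k P.V ↔ res P η = 0 :=
  ⟨h.left_place.residue_eq_zero, h.left_place.mem_regularForms_of_simple_pole hη⟩

theorem hasAtMostSimplePole_of_regular (h : NodeData C x a b P Q) {η : MeroForms C}
    (hη : η P.pt ∈ regularForms k P.V) : HasAtMostSimplePole P η :=
  fun _ ht => h.left_place.smul_mem_regularForms hη (P.V.mem_nonunits_iff.1 ht).le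

/-- The pair of residues at P and Q identifies the quotient with k × k: a simple pole without
residue is no pole. -/
theorem finrank_allowedAt (h : NodeData C x a b P Q) :
    Module.finrank k (allowedAt C x ⧸ (regularAt C x).submoduleOf (allowedAt C x)) = 2 := by
  let L : allowedAt C x →ₗ[k] k × k :=
    ((res P).comp (allowedAt C x).subtype).prod ((res Q).comp (allowedAt C x).subtype)
  have hker : LinearMap.ker L = (regularAt C x).submoduleOf (allowedAt C x) := by
    ext ⟨η, hη⟩
    obtain ⟨hP, hQ⟩ := h.mem_allowedAt.1 hη
    rw [Submodule.submoduleOf, Submodule.mem_comap, Submodule.subtype_apply, h.mem_regularAt,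
      h.regular_iff hP, h.symm.regular_iff hQ, LinearMap.mem_ker]
    exact Prod.mk_eq_zero
  have hsurj : Function.Surjective L := by
    rintro ⟨c, d⟩
    obtain ⟨η, hP, hP1, hQ⟩ := h.exists_form
    obtain ⟨η', hQ', hQ1, hP'⟩ := h.symm.exists_form
    have hη : η ∈ allowedAt C x := h.mem_allowedAt.2 ⟨hP, h.symm.hasAtMostSimplePole_of_regular hQ⟩
    have hη' : η' ∈ allowedAt C x := h.mem_allowedAt.2 ⟨h.hasAtMostSimplePole_of_regular hP', hQ'⟩
    have h1 : res Q η = 0 := h.right_place.residue_eq_zero hQ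
    have h2 : res P η' = 0 := h.left_place.residue_eq_zero hP'
    refine ⟨c • ⟨η, hη⟩ + d • ⟨η', hη'⟩, Prod.ext ?_ ?_⟩
    · change res P (c • η + d • η') = c
      rw [map_add, map_smul, map_smul, hP1, h2, smul_zero, add_zero, smul_eq_mul, mul_one]
    · change res Q (c • η + d • η') = d
      rw [map_add, map_smul, map_smul, h1, hQ1, smul_zero, zero_add, smul_eq_mul, mul_one]
  rw [← hker, (L.quotKerEquivOfSurjective hsurj).finrank_eq, Module.finrank_prod,
    Module.finrank_self]

/-- The residue at P alone suffices, since balancing determines the one at Q; differences of the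
forms in `exists_form` realize every value. -/
theorem finrank_balancedAt (h : NodeData C x a b P Q) :
    Module.finrank k (balancedAt C x ⧸ (regularAt C x).submoduleOf (balancedAt C x)) = 1 := by
  let L : balancedAt C x →ₗ[k] k := (res P).comp (balancedAt C x).subtype
  have hker : LinearMap.ker L = (regularAt C x).submoduleOf (balancedAt C x) := by
    ext ⟨η, hη⟩
    obtain ⟨hP, hQ, h0⟩ := h.mem_balancedAt.1 hη
    rw [Submodule.submoduleOf, Submodule.mem_comap, Submodule.subtype_apply, h.mem_regularAt,
      h.regular_iff hP, h.symm.regular_iff hQ, LinearMap.mem_ker]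
    refine ⟨fun (h1 : res P η = 0) => ⟨h1, ?_⟩, fun h1 => h1.1⟩
    rwa [h1, zero_add] at h0
  have hsurj : Function.Surjective L := by
    intro c
    obtain ⟨η, hP, hP1, hQ⟩ := h.exists_form
    obtain ⟨η', hQ', hQ1, hP'⟩ := h.symm.exists_form
    have h1 : res Q η = 0 := h.right_place.residue_eq_zero hQ
    have h2 : res P η' = 0 := h.left_place.residue_eq_zero hP'
    have hη : η - η' ∈ balancedAt C x := by
      refine h.mem_balancedAt.2 ⟨fun t ht => ?_, fun t ht => ?_, ?_⟩
      · rw [Pi.sub_apply, smul_sub]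
        exact Submodule.sub_mem _ (hP t ht) (h.hasAtMostSimplePole_of_regular hP' t ht)
      · rw [Pi.sub_apply, smul_sub]
        exact Submodule.sub_mem _ (h.symm.hasAtMostSimplePole_of_regular hQ t ht) (hQ' t ht)
      · rw [map_sub, map_sub, hP1, h1, h2, hQ1]
        ring
    refine ⟨c • ⟨η - η', hη⟩, ?_⟩
    change res P (c • (η - η')) = c
    rw [map_smul, map_sub, hP1, h2, sub_zero, smul_eq_mul, mul_one]
  rw [← hker, (L.quotKerEquivOfSurjective hsurj).finrank_eq, Module.finrank_self]

end NodeData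

/-! ### Smooth points -/

theorem IsSmoothPt.exists_uniformizer (hx : IsSmoothPt C x) :
    ∃ z ∈ maximalIdeal (LocRing C x), ∀ P : Branch C x, toFunField C P.specializes z ≠ 0 ∧
      RingHom.ker (toFunField C P.specializes) = ⊥ ∧
      ∀ a, toFunField C P.specializes a ≠ 0 → ∃ (n : ℕ) (u : LocRing C x),
        u ∉ maximalIdeal (LocRing C x) ∧ a = z ^ n * u := by
  obtain ⟨-, hdom, hdvr⟩ := hx
  obtain ⟨z, hz⟩ := IsDiscreteValuationRing.exists_irreducible (LocRing C x)
  refine ⟨z, hz.not_isUnit, fun P => ?_⟩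
  have hker : RingHom.ker (toFunField C P.specializes) = ⊥ := by
    have := (isCurveGerm_toFunField C x).ker_mem_minimalPrimes ⟨P.pt, P.specializes⟩
    rwa [IsDomain.minimalPrimes_eq_singleton_bot] at this
  refine ⟨fun h0 => hz.ne_zero ?_, hker, fun a ha => ?_⟩
  · have : z ∈ RingHom.ker (toFunField C P.specializes) := h0
    rwa [hker] at this
  · have ha0 : a ≠ 0 := by
      rintro rfl
      exact ha (map_zero _)
    obtain ⟨n, u, e⟩ := IsDiscreteValuationRing.eq_unit_mul_pow_irreducible ha0 hz
    exact ⟨n, u, fun hu => hu u.isUnit, by rw [e, mul_comm]⟩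

theorem IsSmoothPt.valuation_eq_pow {P : Branch C x} {z u : LocRing C x} {n : ℕ}
    (hu : u ∉ maximalIdeal (LocRing C x)) :
    P.V.valuation (toFunField C P.specializes (z ^ n * u)) =
      P.V.valuation (toFunField C P.specializes z) ^ n := by
  rw [map_mul, map_mul, P.dominates.eq_one hu, mul_one, map_pow, map_pow]

/-- The local ring is a domain, so only one component passes through x, and the exponent of z in its
discrete valuation determines every dominating valuation ring. -/
theorem IsSmoothPt.subsingleton_branch (hx : IsSmoothPt C x) : Subsingleton (Branch C x) := by
  obtain ⟨z, hzm, hz⟩ := hx.exists_uniformizer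
  refine ⟨fun P Q => ?_⟩
  have hpt := (isCurveGerm_toFunField C x).eq_of_ker_le ⟨P.pt, P.specializes⟩
    ⟨Q.pt, Q.specializes⟩ ((hz P).2.1.trans (hz Q).2.1.symm).le
  obtain ⟨ξ, h, V, h1, h2⟩ := P
  obtain ⟨ξ', h', V', h1', h2'⟩ := Q
  obtain rfl : ξ = ξ' := congrArg Subtype.val hpt
  obtain rfl : V = V' := by
    refine valuationSubring_eq (toFunField_frac h) (V.mem_nonunits_iff.1 (h2 z hzm))
      (V'.mem_nonunits_iff.1 (h2' z hzm)) (hz ⟨ξ, h, V, h1, h2⟩).1 fun a ha => ?_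
    obtain ⟨n, u, hu, rfl⟩ := (hz ⟨ξ, h, V, h1, h2⟩).2.2 a ha
    exact ⟨n, IsSmoothPt.valuation_eq_pow (P := ⟨ξ, h, V, h1, h2⟩) hu,
      IsSmoothPt.valuation_eq_pow (P := ⟨ξ, h, V', h1', h2'⟩) hu⟩
  rfl

theorem IsSmoothPt.isRationalPlace [IsAlgClosed k] [CharZero k] [LocallyOfFiniteType C.hom]
    (hx : IsSmoothPt C x) (P : Branch C x) :
    IsRationalPlace k P.V ∧ ∃ z, IsUniformizer P.V (toFunField C P.specializes z) := by
  have hess := essFiniteType_locRing (k := k) x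
  obtain ⟨z, hzm, hz⟩ := hx.exists_uniformizer
  refine ⟨P.dominates.isRationalPlace (fun c => toFunField_algebraMap C P.specializes c)
    (exists_sub_algebraMap_mem hx.1) P.frac hzm (hz P).1 (e := 0) (by simp) fun a ha => ?_, z,
    P.dominates.lt_one z hzm, (hz P).1, fun g hg => ?_⟩
  · obtain ⟨n, u, hu, rfl⟩ := (hz P).2.2 a ha
    exact ⟨n, Polynomial.C u, 1, by rw [Polynomial.eval₂_C, P.dominates.eq_one hu], by simp,
      by simp⟩
  · obtain ⟨a, b, hb, rfl⟩ := P.frac g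
    obtain ⟨n, u, hu, rfl⟩ := (hz P).2.2 a fun ha => hg (by rw [ha, zero_div])
    obtain ⟨m, w, hw, rfl⟩ := (hz P).2.2 b hb
    refine ⟨(n : ℤ) - m, ?_⟩
    rw [map_div₀, IsSmoothPt.valuation_eq_pow hu, IsSmoothPt.valuation_eq_pow hw, zpow_sub₀,
      zpow_natCast, zpow_natCast]
    exact (Valuation.ne_zero_iff _).2 (hz P).1

/-- With one place the pairing is a single residue. Elements of V are approximated by O past the
pole order of η, so all residues of vη vanish and η has no pole. -/
theorem IsSmoothPt.dualizingAt_le_allowedAt [IsAlgClosed k] [CharZero k]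
    [LocallyOfFiniteType C.hom] (hx : IsSmoothPt C x) : dualizingAt C x ≤ allowedAt C x := by
  have hsub := hx.subsingleton_branch
  intro η hη
  simp only [allowedAt, Submodule.mem_iInf, Submodule.mem_comap]
  intro f _ P
  obtain ⟨hP, z, hz⟩ := hx.isRationalPlace P
  refine hP.smul_mem_regularForms (hP.mem_regularForms_of_residue fun v hv => ?_)
    (P.dominates.le_one f)
  obtain ⟨N, hN⟩ := hP.exists_pow_smul_mem hz.lt_one (η P.pt)
  obtain ⟨p, hp⟩ := exists_approx hP (fun c => toFunField_algebraMap C P.specializes c) hz N hv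
  have h1 := hP.residue_eq_zero (hN _ hp)
  have h2 := (Submodule.mem_iInf _).1 hη p
  have huniq : Unique (Branch C x) := ⟨⟨P⟩, fun Q => Subsingleton.elim Q P⟩
  rw [LinearMap.mem_ker, resPairing, finsum_eq_single _ P fun Q hQ =>
    absurd (Subsingleton.elim Q P) hQ] at h2
  rw [sub_smul, map_sub, sub_eq_zero] at h1
  change residue k P.V (v • η P.pt) = 0
  rw [h1]
  exact h2

/-! ### Maximal variation -/

/-- Only the pointwise inclusion of dualizing into allowed forms needs geometry. The dimension
formula is rank-nullity for cardinal ranks, so no finiteness of the spaces of forms is required. -/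
theorem IsNodalCurve.maximalVariation [IsAlgClosed k] [CharZero k] (hC : IsNodalCurve C) :
    MaximalVariation C := by
  have := hC.proper
  have := hC.reduced
  have hle : ∀ x : ClosedPt C, dualizingAt C x.1 ≤ allowedAt C x.1 := fun x => by
    rcases hC.smooth_or_node x.1 x.2 with hx | hx
    · exact hx.dualizingAt_le_allowedAt
    · obtain ⟨a, b, P, Q, h⟩ := hx.exists_nodeData
      exact h.dualizingAt_le_allowedAt
  have hle' : canonicalForms C ≤ allowedForms C := iInf_mono hle
  refine ⟨iInf_mono fun x => le_inf (hle x) le_rfl, iInf_mono fun x => inf_le_right, ?_⟩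
  have hker : LinearMap.ker (conductorConstraints C) =
      (canonicalForms C).submoduleOf (allowedForms C) := by
    ext η
    simp only [LinearMap.mem_ker, Submodule.submoduleOf, Submodule.mem_comap, canonicalForms,
      dualizingAt, Submodule.mem_iInf, conductorConstraints, funext_iff,
      LinearMap.pi_apply, Pi.zero_apply]
    rfl
  rw [← LinearMap.rank_range_add_rank_ker (conductorConstraints C), hker, add_comm,
    (Submodule.submoduleOfEquivOfLe hle').rank_eq]

end Curve

end

end NodalMV

theorem mainTheorem6 {k : Type u} [Field k] [IsAlgClosed k] [CharZero k] :
    (∀ C : Over (Spec (CommRingCat.of k)), NodalMV.IsNodalCurve C →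
      (∀ x : C.left, NodalMV.IsNode C x →
        NodalMV.conductor C x = IsLocalRing.maximalIdeal (NodalMV.LocRing C x) ∧
        (∃ P Q : NodalMV.Branch C x, P ≠ Q ∧ (∀ R : NodalMV.Branch C x, R = P ∨ R = Q) ∧
          ∀ η : NodalMV.MeroForms C,
            (η ∈ NodalMV.balancedAt C x ↔
              NodalMV.HasAtMostSimplePole P η ∧ NodalMV.HasAtMostSimplePole Q η ∧
                NodalMV.res P η + NodalMV.res Q η = 0) ∧
            (η ∈ NodalMV.dualizingAt C x ↔
              NodalMV.HasAtMostSimplePole P η ∧ NodalMV.HasAtMostSimplePole Q η ∧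
                NodalMV.res P η + NodalMV.res Q η = 0)) ∧
        Module.finrank k (NodalMV.allowedAt C x ⧸
          (NodalMV.regularAt C x).submoduleOf (NodalMV.allowedAt C x)) = 2 ∧
        Module.finrank k (NodalMV.balancedAt C x ⧸
          (NodalMV.regularAt C x).submoduleOf (NodalMV.balancedAt C x)) = 1) ∧
      NodalMV.MaximalVariation C) ∧
    ∀ g n : ℕ, NodalMV.mvLocus k g n = Set.univ := by
  refine ⟨fun C hC => ⟨fun x hx => ?_, hC.maximalVariation⟩, fun g n =>
    Set.eq_univ_of_forall fun S => S.nodal.maximalVariation⟩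
  have := hC.proper
  have := hC.reduced
  obtain ⟨a, b, P, Q, h⟩ := hx.exists_nodeData
  exact ⟨h.conductor_eq, ⟨P, Q, h.ne, h.eq_or_eq, fun η => ⟨h.mem_balancedAt, h.mem_dualizingAt⟩⟩,
    h.finrank_allowedAt, h.finrank_balancedAt⟩
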